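/- **Conventions.** Let $n\ge 1$ and let $\alpha=(\alpha_1,\dots,\alpha_\ell)$ be a composition of $n$. A word in the distinct letters $1,\dots,n$ is regarded as a permutation in $\mathfrak S_n$ (one-line notation). Let $\preceq_L,\preceq_R$ be the left and right weak Bruhat orders on $\mathfrak S_n$, let $\mathrm{Des}_L,\mathrm{Des}_R$ denote left and right descent sets, and for $\sigma\preceq_L\rho$ put $[\sigma,\rho]_L=\{\gamma:\sigma\preceq_L\gamma\preceq_L\rho\}$; $\mathrm{Int}(n)$ is the set of these intervals. Two intervals are equivalent if there is an isomorphism of posets (for $\preceq_L$) between them that preserves left descent sets. An equivalence class $C$ is ordered by $[\sigma,\rho]_L\preceq[\sigma',\rho']_L$ iff $\sigma\preceq_R\sigma'$. For $S\subseteq[n-1]$ let $w_0(S)$ be the longest element of the parabolic subgroup generated by $s_i$, $i\in S$, let $w_1(S)$ be the longest element of $\{z:\mathrm{Des}_R(z)\subseteq S\}$, and let $S^{c}=[n-1]\setminus S$. For a composition $\beta=(\beta_1,\dots,\beta_k)$ of $n$ let $\mathrm{set}(\beta)=\{\beta_1,\beta_1+\beta_2,\dots,\beta_1+\dots+\beta_{k-1}\}$.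 A diagram is a set $D$ of $n$ boxes $(x,y)$ (column $x$ from the left, row $y$ from the bottom), with no empty row or column, whose enclosing rectangle has lower left box $(1,1)$. Let $\mathsf r(D)$ be the list of the numbers of boxes of the rows of $D$ from top to bottom, and $D^x$ the diagram obtained by reflecting $D$ in the $x$-axis and shifting. A strictly upper-right pair of $D$ is a pair of boxes $(x_1,y_1),(x_2,y_2)\in D$ with $x_1<x_2$, $y_1<y_2$ such that no other box of $D$ lies in the smallest rectangle containing both. A standard filling of $D$ is a bijection $F:D\to[n]$. Its poset $P_F$ on $[n]$ is given by $i\preceq_{P_F} j$ iff the box of $i$ is weakly left of and weakly below the box of $j$. A standard filling $T$ is a standard tableau, $T\in\mathrm{ST}(D)$, if $T(i,j)\le T(k,l)$ whenever $i\le k$, $j\le l$. For a filling $T$ of $D^x$ let $T^x$ be the reflected filling of $D$. For a poset $P$ on $[n]$ put $\Sigma_L(P)=\{\sigma\in\mathfrak S_n:\sigma(i)\le\sigma(j)\text{ whenever } i\preceq_P j\}$. For fillings $R,F$ of the same diagram, $\mathrm{read}_R(F)$ is the word of the entries of $F$ read in the order of the boxes labelled $1,2,\dots,n$ in $R$. For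 tableaux in $\mathrm{ST}(D)$ put $T\trianglelefteq U$ iff $\mathrm{read}^{\downarrow}(T)\preceq_L\mathrm{read}^{\downarrow}(U)$, where $\mathrm{read}^{\downarrow}$ reads the columns from left to right, each from top to bottom. **Canonical class.** Let $\mathrm{cd}(\alpha)=\{(x,y):1\le y\le\ell,\ 1\le x\le\alpha_y\}$. A standard Young composition tableau (SYCT) of shape $\alpha$ is a standard filling $\tau$ of $\mathrm{cd}(\alpha)$ whose rows increase from left to right, whose first column increases from bottom to top, and such that if $i>j$, $(k,i),(k+1,j)\in\mathrm{cd}(\alpha)$ and $\tau(k,i)<\tau(k+1,j)$, then $(k+1,i)\in\mathrm{cd}(\alpha)$ and $\tau(k+1,i)<\tau(k+1,j)$. Let $\mathcal T_{\mathrm{src}}$ be the SYCT with $1,\dots,n$ filled in each row from left to right, starting from the bottom row. The canonical class $\mathcal C$ consists of the SYCT of shape $\alpha$ whose entries have, in each column, the same relative order as those of $\mathcal T_{\mathrm{src}}$; it is the basis of the canonical submodule $\widehat{\mathbf S}_{\alpha,\mathcal C}$ of the Young quasisymmetric Schur module. A number $i\in[n-1]$ is a descent of $\tau$ if $i+1$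 is weakly left of $i$ in $\tau$; a descent is attacking if $i,i+1$ are in the same column, or $i+1$ is in the column immediately to the left of that of $i$ and strictly above $i$. A sink is a $\tau\in\mathcal C$ all of whose descents are attacking. Let $\mathrm{read}(\tau)$ be the word read by rows from the bottom row, each from right to left, and let $C$ be the equivalence class of $\{\mathrm{read}(\tau):\tau\in\mathcal C\}$. **The diagram $D_{\alpha,\mathcal C}$.** Let $X_i=\{(1,i),\dots,(\alpha_i,i)\}$. Let $\mathsf{BB}(\alpha)$ consist of the boxes $(1,y)\in\mathrm{cd}(\alpha)$ with $y=\ell$, or $y<\ell$ and $\alpha_y>1$, and of the boxes $(x,y)\in\mathrm{cd}(\alpha)$ with $x>1$ such that no box of $\mathrm{cd}(\alpha)$ lies strictly above row $y$ in column $x$ or $x-1$. List it as $(b_1,d_1),\dots,(b_l,d_l)$ by increasing $b$ and, for equal $b$, increasing $d$; put $d_0=0$. For $j=1,\dots,l$ successively, start $Y_j$ with $(1,d_j),(1,d_j-1),\dots,(1,d_{j-1}+1)$ if $b_j=1$, and with $(b_j,d_j)$ otherwise. Then, as long as some box not in $Y_1\cup\dots\cup Y_{j-1}$ lies in the column immediately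 to the right of the last box of $Y_j$ and strictly below that box, append the lowermost such box to $Y_j$. Put $\mathscr C:=D_{\alpha,\mathcal C}=\{(i,j):X_i\cap Y_j\ne\emptyset\}$. **Proposition.** $\mathscr C$ is a diagram with $n$ boxes and has no strictly upper-right pair. The set $\{\mathrm{read}(\tau):\tau\in\mathcal C\}$ is an interval in $\mathrm{Int}(n)$, and $\mathcal C$ has exactly one sink $\mathcal T_{\mathrm{sink}}$. Let $R$ be the standard filling of $\mathrm{cd}(\alpha)$ that orders its boxes by $Y_l,Y_{l-1},\dots,Y_1$ and, inside each $Y_j$, by increasing entries of $\mathcal T_{\mathrm{sink}}$. (a) $C=\{\Sigma_L(P_{T^x}) : T\in\mathrm{ST}(\mathscr C^x)\}$. Furthermore $$\min C=[\,w_0(\mathrm{set}(\alpha)^{c}),\ \mathrm{read}(\mathcal T_{\mathrm{sink}})\,]_L,\qquad \max C=[\,\mathrm{read}_{R}(\mathcal T_{\mathrm{src}}),\ w_1(\mathrm{set}(\mathsf r(\mathscr C)))\,]_L .$$ Here $w_1(\mathrm{set}(\mathsf r(\mathscr C)))=\mathrm{read}_R(\mathcal T_{\mathrm{sink}})$, and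 $\mathrm{read}_R(\mathcal T_{\mathrm{src}})$ is the word obtained by reading, by rows from the top row and each from left to right, the standard tableau on $\mathscr C$ in which $1,\dots,n$ are filled in along the columns from bottom to top, starting with the leftmost column. (b) The map $T\mapsto\Sigma_L(P_{T^x})$ is an isomorphism of posets $(\mathrm{ST}(\mathscr C^x),\trianglelefteq)\to(C,\preceq)$. -/

import Mathlib

/-!
Conventions.  `[n] = {1, …, n}` is modelled by `Fin n` (the label `k` is the element with value
`k - 1`) and `[n-1]` by `Fin (n-1)` in the same way.  A word `w₁ ⋯ wₙ` in distinct letters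
from `[n]` is the permutation `k ↦ wₖ`, and permutations are multiplied as functions.
-/

namespace HeckeDiagrams

/-! ## The symmetric group and its weak Bruhat orders -/

section SymmetricGroup

variable {n : ℕ}

/-- The simple transposition `s_i = (i, i+1)`. -/
def simple (i : Fin (n - 1)) : Equiv.Perm (Fin n) :=
  Equiv.swap ⟨i.1, by omega⟩ ⟨i.1 + 1, by omega⟩

/-- The length: the least number of simple transpositions in an expression of `σ`. -/
noncomputable def len (σ : Equiv.Perm (Fin n)) : ℕ :=
  sInf {k | ∃ l : List (Fin (n - 1)), l.length = k ∧ (l.map simple).prod = σ}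

/-- The left descent set. -/
def desL (σ : Equiv.Perm (Fin n)) : Set (Fin (n - 1)) := {i | len (simple i * σ) < len σ}

/-- The right descent set. -/
def desR (σ : Equiv.Perm (Fin n)) : Set (Fin (n - 1)) := {i | len (σ * simple i) < len σ}

/-- The left weak Bruhat order. -/
def leL : Equiv.Perm (Fin n) → Equiv.Perm (Fin n) → Prop :=
  Relation.ReflTransGen fun σ τ => ∃ i, i ∉ desL σ ∧ τ = simple i * σ

/-- The right weak Bruhat order. -/
def leR : Equiv.Perm (Fin n) → Equiv.Perm (Fin n) → Prop :=
  Relation.ReflTransGen fun σ τ => ∃ i, i ∉ desR σ ∧ τ = σ * simple i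

/-- The set `[σ, ρ]_L`. -/
def intervalL (σ ρ : Equiv.Perm (Fin n)) : Set (Equiv.Perm (Fin n)) :=
  {γ | leL σ γ ∧ leL γ ρ}

/-- `I ∈ Int(n)`: `I` is a nonempty left weak Bruhat interval. -/
def IsInterval (I : Set (Equiv.Perm (Fin n))) : Prop :=
  ∃ σ ρ, leL σ ρ ∧ I = intervalL σ ρ

/-- An element of maximal length of a set of permutations. -/
noncomputable def longest (A : Set (Equiv.Perm (Fin n))) : Equiv.Perm (Fin n) :=
  Classical.epsilon fun w => w ∈ A ∧ ∀ v ∈ A, len v ≤ len w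

/-- `w₀(S)`: the longest element of the parabolic subgroup generated by the `s_i`, `i ∈ S`. -/
noncomputable def w0 (S : Set (Fin (n - 1))) : Equiv.Perm (Fin n) :=
  longest (Subgroup.closure (simple '' S) : Set (Equiv.Perm (Fin n)))

/-- `w₁(T)`: the longest element of `𝔖^{Tᶜ} = {z | Des_R(z) ⊆ T}`. -/
noncomputable def w1 (T : Set (Fin (n - 1))) : Equiv.Perm (Fin n) :=
  longest {z | desR z ⊆ T}

/-- There is a descent-preserving poset isomorphism `(I, ⪯_L) → (J, ⪯_L)`. -/
def DescentEquiv (I J : Set (Equiv.Perm (Fin n))) : Prop :=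
  ∃ f : I ≃ J, (∀ a b : I, leL a.1 b.1 ↔ leL (f a).1 (f b).1) ∧
    ∀ a : I, desL a.1 = desL (f a).1

/-- The class in `Int(n)` of the interval `I`. -/
def eqClass (I : Set (Equiv.Perm (Fin n))) : Set (Set (Equiv.Perm (Fin n))) :=
  {J | IsInterval J ∧ DescentEquiv I J}

/-- The order on a class: `[σ, ρ]_L ⪯ [σ', ρ']_L` iff `σ ⪯_R σ'`. -/
def classLE (I J : Set (Equiv.Perm (Fin n))) : Prop :=
  ∃ σ ρ σ' ρ', leL σ ρ ∧ I = intervalL σ ρ ∧ leL σ' ρ' ∧ J = intervalL σ' ρ' ∧ leR σ σ'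

/-- `I = min C`. -/
def IsMinOf (C : Set (Set (Equiv.Perm (Fin n)))) (I : Set (Equiv.Perm (Fin n))) : Prop :=
  I ∈ C ∧ ∀ J ∈ C, classLE I J

/-- `I = max C`. -/
def IsMaxOf (C : Set (Set (Equiv.Perm (Fin n)))) (I : Set (Equiv.Perm (Fin n))) : Prop :=
  I ∈ C ∧ ∀ J ∈ C, classLE J I

/-- `Σ_L(P)` for a poset `P` on `[n]`. -/
def sigmaL (P : PartialOrder (Fin n)) : Set (Equiv.Perm (Fin n)) :=
  {σ | ∀ i j, P.le i j → σ i ≤ σ j}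

/-- `set(l₁, …, l_k) = {l₁, l₁ + l₂, …, l₁ + ⋯ + l_{k-1}} ⊆ [n-1]` for positive integers
`l₁, …, l_k` with sum `n`.  (The element of value `i` of `Fin (n-1)` stands for `i + 1`; the empty
and the full partial sum, `0` and `n`, are not of this form.) -/
def partialSums (n : ℕ) (l : List ℕ) : Set (Fin (n - 1)) :=
  {i | ∃ k, (l.take k).sum = i.1 + 1}

end SymmetricGroup

/-! ## Diagrams and fillings -/

/-- A box `(x, y)`: column `x` from the left, row `y` from the bottom. -/
abbrev Box := ℕ × ℕ

/-- `D ∈ 𝔇_n`: `n` boxes with positive coordinates, no empty row or column, with lower left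
corner of the enclosing rectangle at `(1, 1)`. -/
def IsDiagram (n : ℕ) (D : Finset Box) : Prop :=
  D.card = n ∧ (∀ b ∈ D, 1 ≤ b.1 ∧ 1 ≤ b.2) ∧
    (∀ b ∈ D, ∀ x, 1 ≤ x → x ≤ b.1 → ∃ c ∈ D, c.1 = x) ∧
    (∀ b ∈ D, ∀ y, 1 ≤ y → y ≤ b.2 → ∃ c ∈ D, c.2 = y)

/-- A strictly upper-right pair of boxes of `D`. -/
def IsStrictUpperRightPair (D : Finset Box) (a b : Box) : Prop :=
  a ∈ D ∧ b ∈ D ∧ a.1 < b.1 ∧ a.2 < b.2 ∧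
    ∀ c ∈ D, a.1 ≤ c.1 → c.1 ≤ b.1 → a.2 ≤ c.2 → c.2 ≤ b.2 → c = a ∨ c = b

/-- `D` is free of a strictly upper-right configuration. -/
def IsFree (D : Finset Box) : Prop := ∀ a b, ¬ IsStrictUpperRightPair D a b

/-- The number of rows of `D` (for `D ∈ 𝔇_n`). -/
def height (D : Finset Box) : ℕ := D.sup Prod.snd

/-- `r(D)`: the numbers of boxes in the rows of `D`, from the top row to the bottom row. -/
def rowLengths (D : Finset Box) : List ℕ :=
  (List.range (height D)).map fun k => (D.filter fun b => b.2 = height D - k).card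

/-- `D^x`: the reflection of `D` in the `x`-axis, shifted back to the first quadrant. -/
def reflectX (D : Finset Box) : Finset Box :=
  D.image fun b => (b.1, height D + 1 - b.2)

/-- The reflection as a bijection from the boxes of `D` to the boxes of `D^x`. -/
noncomputable def reflectEquiv (D : Finset Box) : D ≃ reflectX D :=
  Equiv.ofBijective
    (fun b => ⟨(b.1.1, height D + 1 - b.1.2), Finset.mem_image.2 ⟨b.1, b.2, rfl⟩⟩) <| by
    constructor
    · rintro ⟨⟨x, y⟩, hb⟩ ⟨⟨x', y'⟩, hc⟩ h
      have h1 : y ≤ height D := Finset.le_sup (f := Prod.snd) hb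
      have h2 : y' ≤ height D := Finset.le_sup (f := Prod.snd) hc
      have h3 : x = x' := congrArg (fun b => b.1.1) h
      have h4 : height D + 1 - y = height D + 1 - y' := congrArg (fun b => b.1.2) h
      have h5 : y = y' := by omega
      subst h3 h5
      rfl
    · rintro ⟨c, hc⟩
      obtain ⟨b, hb, rfl⟩ := Finset.mem_image.1 hc
      exact ⟨⟨b, hb⟩, rfl⟩

/-- A standard filling of `D` with `1, …, n`. -/
abbrev Filling (n : ℕ) (D : Finset Box) := D ≃ Fin n

/-- The filling `T^x` of `D` obtained by reflecting a filling `T` of `D^x`. -/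
noncomputable def unreflect {n : ℕ} {D : Finset Box} (T : Filling n (reflectX D)) : Filling n D :=
  (reflectEquiv D).trans T

/-- `P_F`: `i ⪯ j` iff the box of `i` is weakly left of and weakly below the box of `j`. -/
@[reducible] def fillingPoset {n : ℕ} {D : Finset Box} (F : Filling n D) : PartialOrder (Fin n) :=
  PartialOrder.lift (fun i => (F.symm i : Box)) (Subtype.val_injective.comp F.symm.injective)

/-- `ST(D)`: the standard tableaux on `D`. -/
def stdTableaux (n : ℕ) (D : Finset Box) : Set (Filling n D) :=
  {T | ∀ a b : D, a.1.1 ≤ b.1.1 → a.1.2 ≤ b.1.2 → T a ≤ T b}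

theorem card_key_lt_strictMono {D : Finset Box} (key : D → ℤ ×ₗ ℤ) {a b : D}
    (hab : key a < key b) :
    (Finset.univ.filter fun c => key c < key a).card <
      (Finset.univ.filter fun c => key c < key b).card := by
  apply Finset.card_lt_card
  refine (Finset.ssubset_iff_of_subset ?_).2 ⟨a, by simpa using hab, by simp⟩
  intro c hc
  simp only [Finset.mem_filter, Finset.mem_univ, true_and] at hc ⊢
  exact hc.trans hab

/-- The filling of `D` with `1, …, n` in increasing order of the key of the boxes: the entry of a
box is one more than the number of boxes with smaller key. -/
noncomputable def orderFilling {n : ℕ} {D : Finset Box} (h : D.card = n) (key : D → ℤ ×ₗ ℤ)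
    (hk : Function.Injective key) : Filling n D :=
  Equiv.ofBijective
    (fun b => ⟨(Finset.univ.filter fun c => key c < key b).card, by
      have h1 : (Finset.univ.filter fun c => key c < key b).card < (Finset.univ : Finset D).card :=
        Finset.card_lt_card
          ((Finset.ssubset_iff_of_subset (Finset.filter_subset _ _)).2 ⟨b, by simp, by simp⟩)
      simpa [h] using h1⟩) <| by
    refine (Fintype.bijective_iff_injective_and_card _).2 ⟨?_, by simpa using h⟩
    intro a b hab
    have hab' := congrArg Fin.val hab
    dsimp only at hab'
    by_contra hne
    rcases lt_or_gt_of_ne (fun h' => hne (hk h')) with hlt | hlt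
    · exact absurd hab' (card_key_lt_strictMono key hlt).ne
    · exact absurd hab' (card_key_lt_strictMono key hlt).ne'

/-- The word `read_R(F)`: the entries of `F` read in the order given by the labels of `R`. -/
def readAlong {n : ℕ} {D : Finset Box} (R F : Filling n D) : Equiv.Perm (Fin n) :=
  R.symm.trans F

theorem Filling.card_eq {n : ℕ} {D : Finset Box} (F : Filling n D) : D.card = n := by
  simpa using Fintype.card_congr F

/-- Columns from left to right, each column from top to bottom. -/
def keyTBLR {D : Finset Box} (b : D) : ℤ ×ₗ ℤ := toLex ((b.1.1 : ℤ), -(b.1.2 : ℤ))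

/-- Rows from top to bottom, each row from left to right. -/
def keyLRTB {D : Finset Box} (b : D) : ℤ ×ₗ ℤ := toLex (-(b.1.2 : ℤ), (b.1.1 : ℤ))

/-- Rows from bottom to top, each row from right to left. -/
def keyRLBT {D : Finset Box} (b : D) : ℤ ×ₗ ℤ := toLex ((b.1.2 : ℤ), -(b.1.1 : ℤ))

/-- Rows from bottom to top, each row from left to right. -/
def keyLRBT {D : Finset Box} (b : D) : ℤ ×ₗ ℤ := toLex ((b.1.2 : ℤ), (b.1.1 : ℤ))

/-- Columns from left to right, each column from bottom to top. -/
def keyBTLR {D : Finset Box} (b : D) : ℤ ×ₗ ℤ := toLex ((b.1.1 : ℤ), (b.1.2 : ℤ))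

theorem keyTBLR_injective {D : Finset Box} : Function.Injective (keyTBLR (D := D)) := by
  rintro ⟨⟨x, y⟩, _⟩ ⟨⟨x', y'⟩, _⟩ h
  simpa [keyTBLR] using h

theorem keyLRTB_injective {D : Finset Box} : Function.Injective (keyLRTB (D := D)) := by
  rintro ⟨⟨x, y⟩, _⟩ ⟨⟨x', y'⟩, _⟩ h
  simpa [keyLRTB, and_comm] using h

theorem keyRLBT_injective {D : Finset Box} : Function.Injective (keyRLBT (D := D)) := by
  rintro ⟨⟨x, y⟩, _⟩ ⟨⟨x', y'⟩, _⟩ h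
  simpa [keyRLBT, and_comm] using h

theorem keyLRBT_injective {D : Finset Box} : Function.Injective (keyLRBT (D := D)) := by
  rintro ⟨⟨x, y⟩, _⟩ ⟨⟨x', y'⟩, _⟩ h
  simpa [keyLRBT, and_comm] using h

theorem keyBTLR_injective {D : Finset Box} : Function.Injective (keyBTLR (D := D)) := by
  rintro ⟨⟨x, y⟩, _⟩ ⟨⟨x', y'⟩, _⟩ h
  simpa [keyBTLR] using h

/-- The reading word by columns, top to bottom, from the leftmost column. -/
noncomputable def readTBLR {n : ℕ} {D : Finset Box} (F : Filling n D) : Equiv.Perm (Fin n) :=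
  readAlong (orderFilling F.card_eq keyTBLR keyTBLR_injective) F

/-- The reading word by rows, left to right, from the top row. -/
noncomputable def readLRTB {n : ℕ} {D : Finset Box} (F : Filling n D) : Equiv.Perm (Fin n) :=
  readAlong (orderFilling F.card_eq keyLRTB keyLRTB_injective) F

/-- The reading word by rows, right to left, from the bottom row. -/
noncomputable def readRLBT {n : ℕ} {D : Finset Box} (F : Filling n D) : Equiv.Perm (Fin n) :=
  readAlong (orderFilling F.card_eq keyRLBT keyRLBT_injective) F

/-- `T'_D`: the filling by columns, bottom to top, from the leftmost column. -/
noncomputable def columnTableau {n : ℕ} {D : Finset Box} (h : D.card = n) : Filling n D :=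
  orderFilling h keyBTLR keyBTLR_injective

/-- The order on `ST(D)`: `T ⊴ U` iff the column reading words satisfy `⪯_L`. -/
def tableauLE {n : ℕ} {D : Finset Box} (T U : Filling n D) : Prop :=
  leL (readTBLR T) (readTBLR U)

/-! ## Standard Young composition tableaux and the canonical class -/

section SYCT

variable {n : ℕ}

/-- The composition diagram: row `i` from the bottom has `α_i` boxes, left-justified. -/
def cd (α : Composition n) : Finset Box :=
  (Finset.univ : Finset (Σ i : Fin α.length, Fin (α.blocksFun i))).map
    ⟨fun p => (p.2.1 + 1, p.1.1 + 1), by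
      rintro ⟨i, j⟩ ⟨i', j'⟩ h
      simp only [Prod.mk.injEq, Nat.add_right_cancel_iff] at h
      obtain ⟨h1, h2⟩ := h
      obtain rfl := Fin.ext h2
      obtain rfl := Fin.ext h1
      rfl⟩

theorem card_cd (α : Composition n) : (cd α).card = n := by
  simp [cd, α.sum_blocksFun]

/-- Standard Young composition tableaux of shape `α`: rows increase from left to right, the first
column increases from bottom to top, and the Young triple rule holds: if row `i` is above row `j`
and `τ(k, i) < τ(k+1, j)`, then `(k+1, i)` is a box and `τ(k+1, i) < τ(k+1, j)`. -/
def IsSYCT (α : Composition n) (τ : Filling n (cd α)) : Prop :=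
  (∀ a b : cd α, a.1.2 = b.1.2 → a.1.1 < b.1.1 → τ a < τ b) ∧
  (∀ a b : cd α, a.1.1 = 1 → b.1.1 = 1 → a.1.2 < b.1.2 → τ a < τ b) ∧
  (∀ a b : cd α, b.1.1 = a.1.1 + 1 → b.1.2 < a.1.2 → τ a < τ b →
    ∃ c : cd α, c.1 = (a.1.1 + 1, a.1.2) ∧ τ c < τ b)

/-- The source tableau of the canonical class: `1, …, n` in each row from left to right,
starting from the bottom row. -/
noncomputable def sourceSYCT (α : Composition n) : Filling n (cd α) :=
  orderFilling (card_cd α) keyLRBT keyLRBT_injective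

/-- Two fillings are equivalent if in each column their entries are in the same relative order. -/
def ColumnEquiv {α : Composition n} (τ υ : Filling n (cd α)) : Prop :=
  ∀ a b : cd α, a.1.1 = b.1.1 → (τ a < τ b ↔ υ a < υ b)

/-- The canonical class: the standard Young composition tableaux of shape `α` equivalent to the
source tableau. It is the basis of the canonical submodule. -/
def canonicalSYCT (α : Composition n) : Set (Filling n (cd α)) :=
  {τ | IsSYCT α τ ∧ ColumnEquiv τ (sourceSYCT α)}

/-- `i` is a descent of `τ`: `i + 1` is weakly left of `i`. -/
def IsDescent {α : Composition n} (τ : Filling n (cd α)) (i : Fin (n - 1)) : Prop :=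
  (τ.symm ⟨i.1 + 1, by omega⟩).1.1 ≤ (τ.symm ⟨i.1, by omega⟩).1.1

/-- `i` and `i + 1` are attacking: they are in the same column, or `i + 1` is in the column
immediately left of that of `i` and strictly above `i`. -/
def IsAttacking {α : Composition n} (τ : Filling n (cd α)) (i : Fin (n - 1)) : Prop :=
  (τ.symm ⟨i.1, by omega⟩).1.1 = (τ.symm ⟨i.1 + 1, by omega⟩).1.1 ∨
  ((τ.symm ⟨i.1, by omega⟩).1.1 = (τ.symm ⟨i.1 + 1, by omega⟩).1.1 + 1 ∧
    (τ.symm ⟨i.1, by omega⟩).1.2 < (τ.symm ⟨i.1 + 1, by omega⟩).1.2)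

/-- A sink of the canonical class.  The generator `π_i` of the `0`-Hecke algebra maps `τ` to `τ` if
`i` is not a descent, to `0` if `i` is an attacking descent, and to `s_i · τ` otherwise; `τ` is a
sink if the last case does not occur. -/
def IsSink (α : Composition n) (τ : Filling n (cd α)) : Prop :=
  τ ∈ canonicalSYCT α ∧ ∀ i, IsDescent τ i → IsAttacking τ i

/-- The set of the reading words of the tableaux in the canonical class. -/
noncomputable def canonicalWords (α : Composition n) : Set (Equiv.Perm (Fin n)) :=
  readRLBT '' canonicalSYCT α

/-- The equivalence class of intervals attached to the canonical submodule. -/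
noncomputable def canonicalIntervalClass (α : Composition n) :
    Set (Set (Equiv.Perm (Fin n))) :=
  eqClass (canonicalWords α)

end SYCT

/-! ## The diagram produced by the algorithm -/

section Algorithm

variable {n : ℕ}

/-- `X_i`: the boxes of row `i` of the composition diagram. -/
def rowX (α : Composition n) (i : ℕ) : Finset Box := (cd α).filter fun b => b.2 = i

/-- `BB(α)`: the boxes `(1, y)` with `y = ℓ(α)`, or with `y < ℓ(α)` and `α_y > 1`, and the boxes
`(x, y)` with `x > 1` such that no box is strictly above `(x, y)` in column `x` or `x - 1`. -/
def BB (α : Composition n) : Finset Box :=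
  (cd α).filter fun b =>
    (b.1 = 1 ∧ (b.2 = α.length ∨ (b.2 < α.length ∧ 1 < (rowX α b.2).card))) ∨
    (1 < b.1 ∧ ∀ c ∈ cd α, (c.1 = b.1 ∨ c.1 + 1 = b.1) → ¬ b.2 < c.2)

/-- `BB(α)` listed by increasing column index and, in a column, by increasing row index. -/
def listBB (α : Composition n) : List Box :=
  (((BB α).image toLex).sort (· ≤ ·) : List (ℕ ×ₗ ℕ)).map ofLex

/-- The boxes added to a set `Y` whose last box is `κ`: as long as the next column has a box of `A`
(the boxes not used so far) strictly below the last box, the lowermost such box is added and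
becomes the last box.  The first argument bounds the number of steps. -/
def chain (A : Finset Box) : ℕ → Box → Finset Box
  | 0, _ => ∅
  | f + 1, κ =>
    let S := (A.filter fun b => b.1 = κ.1 + 1 ∧ b.2 < κ.2).image Prod.snd
    if h : S.Nonempty then insert (κ.1 + 1, S.min' h) (chain A f (κ.1 + 1, S.min' h)) else ∅

/-- The sets `Y_1, Y_2, …` built from the remaining list of `BB(α)`; `A` is the set of boxes not
used so far and `p` the row index of the preceding element of `BB(α)` (`0` at the start).
An element `(1, d)` starts the set `{(1, d), (1, d-1), …, (1, p+1)}` with last box `(1, p+1)`,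
every other element `(b, d)` starts the set `{(b, d)}`. -/
def buildY (f : ℕ) : Finset Box → ℕ → List Box → List (Finset Box)
  | _, _, [] => []
  | A, p, κ :: l =>
    let Y := if κ.1 = 1 then (Finset.Ioc p κ.2).image (fun y => (1, y)) ∪ chain A f (1, p + 1)
      else {κ} ∪ chain A f κ
    Y :: buildY f (A \ Y) κ.2 l

/-- The list `Y_1, …, Y_l`.  (There are at most `n` columns, so `n` steps suffice in `chain`.) -/
def listY (α : Composition n) : List (Finset Box) := buildY n (cd α) 0 (listBB α)

/-- `D_{α,𝒞} = {(i, j) | X_i ∩ Y_j ≠ ∅}`. -/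
def canonicalDiagram (α : Composition n) : Finset Box :=
  (Finset.Icc 1 α.length ×ˢ Finset.Icc 1 (listY α).length).filter fun b =>
    (rowX α b.1 ∩ (listY α).getD (b.2 - 1) ∅).Nonempty

/-- The index (counted from `0`) of the set `Y_j` that contains a box. -/
def indexY (α : Composition n) (b : Box) : ℕ := (listY α).findIdx fun Y => decide (b ∈ Y)

/-- The filling `R_τ` that orders the boxes of the composition diagram as follows: the sets `Y_j`
in the order `Y_l, …, Y_1`, and the boxes of each `Y_j` by increasing entries of `τ`. -/
noncomputable def rowOrder (α : Composition n) (τ : Filling n (cd α)) : Filling n (cd α) :=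
  orderFilling (card_cd α)
    (fun b => toLex (-(indexY α b.1 : ℤ), ((τ b).1 : ℤ))) <| by
      intro a b h
      have h2 : (τ a).1 = (τ b).1 := by
        have := congrArg (fun p => (ofLex p).2) h
        simpa using this
      exact τ.injective (Fin.ext h2)

end Algorithm

end HeckeDiagrams

open HeckeDiagrams

/-! Everything about the class is proved for an arbitrary diagram $D$ with $n$ boxes and no strictly
upper-right pair; the combinatorics of compositions enters only through a bijection of boxes.

Call a filling $R$ of $D$ an anti-tableau if it increases to the right and downwards; these are the
fillings $T^x$ with $T\in\mathrm{ST}(D^x)$. Since $\mathrm{read}_R(F)\circ R=F$, the set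
$\Sigma_L(P_R)$ is $\{\mathrm{read}_R(F):F\in\mathrm{ST}(D)\}$, and it is the interval from the
reading of the column tableau to that of the row tableau (`sigmaL_eq_intervalL`). Neither the order
on these words nor their left descents depend on $R$ (`leL_readAlong_iff`, `mem_desL_readAlong_iff`;
the second needs freeness), so all these intervals are equivalent. Conversely, a descent-preserving
isomorphism of intervals is a right translation (`DescentEquiv.eq_mul`), that is, a change of the
reading order $R$; equality of descents then forces the new order to be an anti-tableau
(`isAntiTableau_of_desL_eq`). Thus the class is indexed by anti-tableaux. The bottom of each
interval is $\mathrm{read}_R$ of the column tableau, whose inverse is the word of $R$ along the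
columns, so $\preceq_R$ on bottoms becomes the order on $\mathrm{ST}(D^x)$. The extreme
anti-tableaux order the boxes by columns and by rows.

For a composition, the SYCT in the canonical class are the fillings that increase along rows, along
columns and from $(k+1,j)$ to $(k,i)$ for $j<i$ (`mem_canonicalSYCT_iff`). The algorithm has a
closed form: a box in column $k+1$ lies in the same $Y_j$ as the next higher box of column $k$, and
it opens a new set if there is none (`yIdx`, `listY_eq`). Sending a box to the pair of its row and
its $Y$-index carries the canonical class onto $\mathrm{ST}(\mathscr C)$
(`push_mem_stdTableaux_iff`), the source to the column tableau and the unique sink to the row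
tableau. -/

namespace HeckeDiagrams

/-! ### Inversions, length and the left weak order -/

section SymmetricGroup

variable {n : ℕ}

/-- The smaller of the two letters exchanged by `simple i`. -/
def lo (i : Fin (n - 1)) : Fin n := ⟨i.1, by omega⟩

/-- The larger of the two letters exchanged by `simple i`. -/
def hi (i : Fin (n - 1)) : Fin n := ⟨i.1 + 1, by omega⟩

@[simp] theorem lo_val (i : Fin (n - 1)) : (lo i).1 = i.1 := rfl

@[simp] theorem hi_val (i : Fin (n - 1)) : (hi i).1 = i.1 + 1 := rfl

theorem lo_lt_hi (i : Fin (n - 1)) : lo i < hi i := by simp [lo, hi, Fin.lt_def]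

theorem simple_eq (i : Fin (n - 1)) : simple i = Equiv.swap (lo i) (hi i) := rfl

@[simp] theorem simple_lo (i : Fin (n - 1)) : simple i (lo i) = hi i := Equiv.swap_apply_left _ _

@[simp] theorem simple_hi (i : Fin (n - 1)) : simple i (hi i) = lo i := Equiv.swap_apply_right _ _

@[simp] theorem simple_mul_self (i : Fin (n - 1)) : simple i * simple i = 1 :=
  Equiv.swap_mul_self _ _

@[simp] theorem simple_inv (i : Fin (n - 1)) : (simple i)⁻¹ = simple i := Equiv.swap_inv _ _

@[simp] theorem simple_mul_cancel (i : Fin (n - 1)) (σ : Equiv.Perm (Fin n)) :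
    simple i * (simple i * σ) = σ := by rw [← mul_assoc]; simp

theorem simple_lt_simple {i : Fin (n - 1)} {x y : Fin n} (h : ¬ (x = lo i ∧ y = hi i)) (hxy : x < y) :
    simple i x < simple i y := by
  simp only [simple_eq, Equiv.swap_apply_def, lo, hi, Fin.ext_iff, Fin.lt_def] at *
  split_ifs <;> simp <;> omega

theorem simple_lt_simple_iff {i : Fin (n - 1)} {x y : Fin n} (h : ¬ (x = lo i ∧ y = hi i))
    (h' : ¬ (x = hi i ∧ y = lo i)) : simple i x < simple i y ↔ x < y := by
  refine ⟨fun hlt => ?_, simple_lt_simple h⟩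
  have := simple_lt_simple (i := i) (x := simple i x) (y := simple i y) ?_ hlt
  · simpa [← Equiv.Perm.mul_apply] using this
  · rintro ⟨h1, h2⟩
    rw [← simple_hi i] at h1
    rw [← simple_lo i] at h2
    exact h' ⟨(simple i).injective h1, (simple i).injective h2⟩

/-- The inversions of a permutation, as pairs of positions. -/
def invSet (σ : Equiv.Perm (Fin n)) : Finset (Fin n × Fin n) :=
  Finset.univ.filter fun p => p.1 < p.2 ∧ σ p.2 < σ p.1

theorem mem_invSet {σ : Equiv.Perm (Fin n)} {a b : Fin n} :
    (a, b) ∈ invSet σ ↔ a < b ∧ σ b < σ a := by simp [invSet]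

theorem invSet_simple_mul {i : Fin (n - 1)} {σ : Equiv.Perm (Fin n)}
    (h : σ⁻¹ (lo i) < σ⁻¹ (hi i)) :
    invSet (simple i * σ) = insert (σ⁻¹ (lo i), σ⁻¹ (hi i)) (invSet σ) := by
  ext ⟨a, b⟩
  simp only [Finset.mem_insert, Prod.mk.injEq, mem_invSet, Equiv.Perm.mul_apply,
    Equiv.Perm.eq_inv_iff_eq]
  by_cases h1 : σ a = lo i ∧ σ b = hi i
  · have ha : a = σ⁻¹ (lo i) := by rw [Equiv.Perm.eq_inv_iff_eq]; exact h1.1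
    have hb : b = σ⁻¹ (hi i) := by rw [Equiv.Perm.eq_inv_iff_eq]; exact h1.2
    simp only [h1, and_self, true_or, iff_true, simple_lo, simple_hi, lo_lt_hi, and_true]
    rwa [ha, hb]
  · simp only [h1, false_or, and_congr_right_iff]
    intro hab
    apply simple_lt_simple_iff
    · rintro ⟨h2, h3⟩
      have hb : b = σ⁻¹ (lo i) := by rw [Equiv.Perm.eq_inv_iff_eq]; exact h2
      have ha : a = σ⁻¹ (hi i) := by rw [Equiv.Perm.eq_inv_iff_eq]; exact h3
      rw [ha, hb] at hab
      exact absurd hab h.asymm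
    · rintro ⟨h2, h3⟩
      exact h1 ⟨h3, h2⟩

theorem card_invSet_simple_mul {i : Fin (n - 1)} {σ : Equiv.Perm (Fin n)}
    (h : σ⁻¹ (lo i) < σ⁻¹ (hi i)) :
    (invSet (simple i * σ)).card = (invSet σ).card + 1 := by
  rw [invSet_simple_mul h, Finset.card_insert_of_notMem]
  rw [mem_invSet]
  simpa using fun _ => (lo_lt_hi i).le

theorem simple_mul_inv_lt {i : Fin (n - 1)} {σ : Equiv.Perm (Fin n)}
    (h : σ⁻¹ (hi i) < σ⁻¹ (lo i)) :
    (simple i * σ)⁻¹ (lo i) < (simple i * σ)⁻¹ (hi i) := by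
  simpa [mul_inv_rev] using h

theorem card_invSet_simple_mul' {i : Fin (n - 1)} {σ : Equiv.Perm (Fin n)}
    (h : σ⁻¹ (hi i) < σ⁻¹ (lo i)) :
    (invSet (simple i * σ)).card + 1 = (invSet σ).card := by
  have := card_invSet_simple_mul (simple_mul_inv_lt h)
  rw [simple_mul_cancel] at this
  exact this.symm

/-- Two distinct orderings differ at two letters that are consecutive in the first one. -/
theorem exists_consecutive {σ ρ : Equiv.Perm (Fin n)} (h : σ ≠ ρ) :
    ∃ i : Fin (n - 1), ρ (σ⁻¹ (hi i)) < ρ (σ⁻¹ (lo i)) := by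
  by_contra! hcon
  apply h
  -- Without such letters $\rho\sigma^{-1}$ increases at every consecutive pair, hence everywhere,
  -- and an increasing permutation is the identity.
  have hmono : StrictMono fun x => ρ (σ⁻¹ x) := by
    intro x y hxy
    have key : ∀ d : ℕ, ∀ x y : Fin n, y.1 = x.1 + d + 1 → ρ (σ⁻¹ x) < ρ (σ⁻¹ y) := by
      intro d
      induction d with
      | zero =>
        intro x y hy
        have h1 := hcon ⟨x.1, by omega⟩
        have hx : lo ⟨x.1, by omega⟩ = x := rfl
        have hy' : hi ⟨x.1, by omega⟩ = y := Fin.ext (by simp [hi, hy])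
        rw [hx, hy'] at h1
        refine lt_of_le_of_ne h1 fun he => ?_
        have := σ⁻¹.injective (ρ.injective he)
        rw [this] at hy
        omega
      | succ d ih =>
        intro x y hy
        refine (ih x ⟨x.1 + d + 1, by omega⟩ rfl).trans ?_
        have h1 := hcon ⟨x.1 + d + 1, by omega⟩
        have hy' : hi ⟨x.1 + d + 1, by omega⟩ = y := Fin.ext (by simp [hi, hy]; omega)
        rw [hy'] at h1
        refine lt_of_le_of_ne h1 fun he => ?_
        have := congrArg Fin.val (σ⁻¹.injective (ρ.injective he))
        simp at this
        omega
    exact key (y.1 - x.1 - 1) x y (by rw [Fin.lt_def] at hxy; omega)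
  have hid : (fun x => ρ (σ⁻¹ x)) = id := by
    have hs : Function.Surjective fun x => ρ (σ⁻¹ x) := ρ.surjective.comp σ⁻¹.surjective
    exact congrArg DFunLike.coe
      (Subsingleton.elim (StrictMono.orderIsoOfSurjective _ hmono hs) (OrderIso.refl _))
  ext x
  have := congrFun hid (σ x)
  simp at this
  rw [this]

/-- Bubble sort: a nonidentity permutation has a left descent, and each swap at a descent removes
exactly one inversion. -/
theorem exists_word (σ : Equiv.Perm (Fin n)) :
    ∃ l : List (Fin (n - 1)), l.length = (invSet σ).card ∧ (l.map simple).prod = σ := by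
  induction hk : (invSet σ).card generalizing σ with
  | zero =>
    refine ⟨[], rfl, ?_⟩
    by_contra hne
    obtain ⟨i, hi⟩ := exists_consecutive (Ne.symm hne)
    have := card_invSet_simple_mul' (σ := σ) (i := i) (by simpa using hi)
    omega
  | succ k ih =>
    have hne : σ ≠ 1 := by
      rintro rfl
      have : invSet (1 : Equiv.Perm (Fin n)) = ∅ := by
        ext ⟨a, b⟩
        simpa [mem_invSet] using fun h => h.le
      rw [this] at hk
      simp at hk
    obtain ⟨i, hi⟩ := exists_consecutive hne
    have := card_invSet_simple_mul' (σ := σ) (i := i) (by simpa using hi)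
    obtain ⟨l, hl, hp⟩ := ih (simple i * σ) (by omega)
    exact ⟨i :: l, by simp [hl], by simp [hp]⟩

theorem card_invSet_le_length (l : List (Fin (n - 1))) :
    (invSet (l.map simple).prod).card ≤ l.length := by
  induction l with
  | nil =>
    have : invSet (1 : Equiv.Perm (Fin n)) = ∅ := by
      ext ⟨a, b⟩
      simpa [mem_invSet] using fun h => h.le
    simp [this]
  | cons i l ih =>
    simp only [List.map_cons, List.prod_cons, List.length_cons]
    rcases lt_trichotomy ((l.map simple).prod⁻¹ (lo i)) ((l.map simple).prod⁻¹ (hi i)) with h | h | h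
    · rw [card_invSet_simple_mul h]; omega
    · exact absurd ((Equiv.injective _) h) (lo_lt_hi i).ne
    · have := card_invSet_simple_mul' h; omega

theorem len_eq (σ : Equiv.Perm (Fin n)) : len σ = (invSet σ).card := by
  apply le_antisymm
  · exact Nat.sInf_le (exists_word σ)
  · refine le_csInf ⟨_, exists_word σ⟩ ?_
    rintro k ⟨l, rfl, rfl⟩
    exact card_invSet_le_length l

theorem mem_desL {i : Fin (n - 1)} {σ : Equiv.Perm (Fin n)} :
    i ∈ desL σ ↔ σ⁻¹ (hi i) < σ⁻¹ (lo i) := by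
  rw [desL, Set.mem_ofPred_eq, len_eq, len_eq]
  constructor
  · intro h
    by_contra! hle
    have := card_invSet_simple_mul
      (lt_of_le_of_ne hle fun he => (lo_lt_hi i).ne ((Equiv.injective _) he))
    omega
  · intro h
    have := card_invSet_simple_mul' h
    omega

theorem notMem_desL {i : Fin (n - 1)} {σ : Equiv.Perm (Fin n)} :
    i ∉ desL σ ↔ σ⁻¹ (lo i) < σ⁻¹ (hi i) := by
  rw [mem_desL, not_lt]
  exact ⟨fun h => lt_of_le_of_ne h fun he => (lo_lt_hi i).ne ((Equiv.injective _) he), le_of_lt⟩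

theorem invSet_ext {σ ρ : Equiv.Perm (Fin n)} (h : invSet σ = invSet ρ) : σ = ρ := by
  by_contra hne
  obtain ⟨i, hi'⟩ := exists_consecutive hne
  rcases lt_trichotomy (σ⁻¹ (lo i)) (σ⁻¹ (hi i)) with hlt | heq | hlt
  · have h1 : (σ⁻¹ (lo i), σ⁻¹ (hi i)) ∈ invSet σ := by
      rw [h, mem_invSet]; exact ⟨hlt, hi'⟩
    rw [mem_invSet] at h1
    simp at h1
    exact absurd h1.2 (lo_lt_hi i).asymm
  · exact (lo_lt_hi i).ne ((Equiv.injective _) heq)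
  · have h1 : (σ⁻¹ (hi i), σ⁻¹ (lo i)) ∈ invSet ρ := by
      rw [← h, mem_invSet]; exact ⟨hlt, by simpa using lo_lt_hi i⟩
    rw [mem_invSet] at h1
    exact absurd h1.2 hi'.asymm

/-- This is the working form of the left weak order. For the converse, take consecutive letters of
$\sigma$ whose order $\rho$ reverses: containment shows that they are not yet inverted in $\sigma$,
so swapping them is an upward step whose only new inversion belongs to $\rho$. -/
theorem leL_iff {σ ρ : Equiv.Perm (Fin n)} : leL σ ρ ↔ invSet σ ⊆ invSet ρ := by
  constructor
  · intro h
    induction h with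
    | refl => exact Finset.Subset.refl _
    | tail _ hs ih =>
      obtain ⟨i, hi, rfl⟩ := hs
      refine ih.trans ?_
      rw [invSet_simple_mul (notMem_desL.1 hi)]
      exact Finset.subset_insert _ _
  · intro h
    induction hk : (invSet ρ).card - (invSet σ).card generalizing σ with
    | zero =>
      have : invSet σ = invSet ρ := Finset.eq_of_subset_of_card_le h (by omega)
      rw [invSet_ext this]
      exact Relation.ReflTransGen.refl
    | succ k ih =>
      have hne : σ ≠ ρ := by rintro rfl; omega
      obtain ⟨i, hi'⟩ := exists_consecutive hne
      have hlt : σ⁻¹ (lo i) < σ⁻¹ (hi i) := by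
        rw [← notMem_desL, mem_desL]
        intro hlt
        have h1 : (σ⁻¹ (hi i), σ⁻¹ (lo i)) ∈ invSet ρ :=
          h (mem_invSet.2 ⟨hlt, by simpa using lo_lt_hi i⟩)
        exact absurd (mem_invSet.1 h1).2 hi'.asymm
      refine Relation.ReflTransGen.head ⟨i, notMem_desL.2 hlt, rfl⟩ (ih ?_ ?_)
      · rw [invSet_simple_mul hlt]
        exact Finset.insert_subset (mem_invSet.2 ⟨hlt, hi'⟩) h
      · rw [card_invSet_simple_mul hlt]; omega

theorem leL_refl (σ : Equiv.Perm (Fin n)) : leL σ σ := Relation.ReflTransGen.refl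

theorem leL_antisymm {σ ρ : Equiv.Perm (Fin n)} (h : leL σ ρ) (h' : leL ρ σ) : σ = ρ :=
  invSet_ext (Finset.Subset.antisymm (leL_iff.1 h) (leL_iff.1 h'))

theorem leL_trans {σ ρ τ : Equiv.Perm (Fin n)} (h : leL σ ρ) (h' : leL ρ τ) : leL σ τ :=
  Relation.ReflTransGen.trans h h'

/-! ### Inverses and the right weak order -/

theorem len_inv_le (σ : Equiv.Perm (Fin n)) : len σ⁻¹ ≤ len σ := by
  obtain ⟨l, hl, hp⟩ := exists_word σ
  rw [len_eq σ]
  refine Nat.sInf_le ⟨l.reverse, by simp [hl], ?_⟩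
  rw [← hp, List.prod_inv_reverse, List.map_map, List.map_reverse]
  simp [Function.comp_def]

theorem len_inv (σ : Equiv.Perm (Fin n)) : len σ⁻¹ = len σ :=
  le_antisymm (len_inv_le σ) (by simpa using len_inv_le σ⁻¹)

theorem desR_eq (σ : Equiv.Perm (Fin n)) : desR σ = desL σ⁻¹ := by
  ext i
  rw [desR, desL, Set.mem_ofPred_eq, Set.mem_ofPred_eq, len_inv, ← len_inv (σ * simple i)]
  simp [mul_inv_rev]

theorem leR_iff {σ ρ : Equiv.Perm (Fin n)} : leR σ ρ ↔ leL σ⁻¹ ρ⁻¹ := by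
  constructor
  · intro h
    refine Relation.ReflTransGen.lift (·⁻¹) ?_ _ _ h
    rintro a b ⟨i, hi, rfl⟩
    exact ⟨i, by rwa [← desR_eq], by simp [mul_inv_rev]⟩
  · intro h
    rw [← inv_inv σ, ← inv_inv ρ]
    refine Relation.ReflTransGen.lift (·⁻¹) ?_ _ _ h
    rintro a b ⟨i, hi, rfl⟩
    exact ⟨i, by rwa [desR_eq, inv_inv], by simp [mul_inv_rev]⟩

/-! ### Longest elements of parabolic subgroups and of descent classes -/

/-- Length alone need not single out an element of $A$; containment of all inversion sets does, and
so determines the value of the choice operator. -/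
theorem longest_eq {A : Set (Equiv.Perm (Fin n))} {g : Equiv.Perm (Fin n)} (hg : g ∈ A)
    (h : ∀ v ∈ A, invSet v ⊆ invSet g) : longest A = g := by
  have hs : longest A ∈ A ∧ ∀ v ∈ A, len v ≤ len (longest A) :=
    Classical.epsilon_spec (p := fun w => w ∈ A ∧ ∀ v ∈ A, len v ≤ len w)
      ⟨g, hg, fun v hv => by rw [len_eq, len_eq]; exact Finset.card_le_card (h v hv)⟩
  refine invSet_ext (Finset.eq_of_subset_of_card_le (h _ hs.1) ?_)
  rw [← len_eq, ← len_eq]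
  exact hs.2 g hg

/-- A permutation all of whose inversions `(a, b)` satisfy `[a, b) ⊆ S` is a product of simple
transpositions with index in `S`. -/
theorem mem_closure_of_invSet {S : Set (Fin (n - 1))} {σ : Equiv.Perm (Fin n)}
    (h : ∀ a b, (a, b) ∈ invSet σ → ∀ i, a ≤ lo i → lo i < b → i ∈ S) :
    σ ∈ Subgroup.closure (simple '' S) := by
  induction hk : (invSet σ⁻¹).card generalizing σ with
  | zero =>
    have : (1 : Equiv.Perm (Fin n)) = σ⁻¹ := by
      apply invSet_ext
      rw [Finset.card_eq_zero.1 hk]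
      ext ⟨a, b⟩
      simpa [mem_invSet] using fun h => h.le
    rw [← inv_inv σ, ← this, inv_one]
    exact Subgroup.one_mem _
  | succ k ih =>
    have hne : σ⁻¹ ≠ 1 := by
      intro h1
      rw [h1] at hk
      have : invSet (1 : Equiv.Perm (Fin n)) = ∅ := by
        ext ⟨a, b⟩
        simpa [mem_invSet] using fun h => h.le
      simp [this] at hk
    obtain ⟨i, hi'⟩ := exists_consecutive hne
    simp only [inv_inv, Equiv.Perm.one_apply] at hi'
    have hiS : i ∈ S := h (lo i) (hi i) (mem_invSet.2 ⟨lo_lt_hi i, hi'⟩) i le_rfl (lo_lt_hi i)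
    have hcard := card_invSet_simple_mul' (σ := σ⁻¹) (i := i) (by simpa using hi')
    have hmem : σ * simple i ∈ Subgroup.closure (simple '' S) := by
      apply ih
      · intro a b hab j haj hjb
        rw [mem_invSet] at hab
        by_cases hji : j = i
        · rw [hji]; exact hiS
        have hsd : simple i a < simple i b := by
          apply simple_lt_simple _ hab.1
          rintro ⟨rfl, rfl⟩
          have := hab.2
          simp only [Equiv.Perm.mul_apply, simple_hi, simple_lo] at this
          exact absurd this hi'.asymm
        have hji' : j.1 ≠ i.1 := fun h => hji (Fin.ext h)
        -- An inversion $(a,b)$ of $\sigma s_i$ gives the inversion $(s_i a,s_i b)$ of $\sigma$. The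
        -- endpoints only move across the cut $i$, so a cut $j\ne i$ between $a$ and $b$ stays
        -- between them.
        refine h (simple i a) (simple i b) (mem_invSet.2 ⟨hsd, hab.2⟩) j ?_ ?_ <;>
        · rw [simple_eq, Equiv.swap_apply_def]
          split_ifs <;> simp only [Fin.ext_iff, Fin.lt_def, Fin.le_def, lo_val, hi_val] at * <;>
            omega
      · simp only [mul_inv_rev, simple_inv]; omega
    have := Subgroup.mul_mem _ hmem (Subgroup.subset_closure (Set.mem_image_of_mem simple hiS))
    rwa [mul_assoc, simple_mul_self, mul_one] at this

/-- If $i\notin S$, every generator, hence the whole subgroup, preserves the initial segment ending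
at `lo i`, so no inversion can straddle that cut. -/
theorem invSet_of_mem_closure {S : Set (Fin (n - 1))} {σ : Equiv.Perm (Fin n)}
    (h : σ ∈ Subgroup.closure (simple '' S)) {a b : Fin n} (hab : (a, b) ∈ invSet σ)
    {i : Fin (n - 1)} (hai : a ≤ lo i) (hib : lo i < b) : i ∈ S := by
  by_contra hi'
  have key : ∀ x, σ x ≤ lo i ↔ x ≤ lo i := by
    clear hab
    induction h using Subgroup.closure_induction with
    | mem x hx =>
      obtain ⟨j, hj, rfl⟩ := hx
      have hji : j ≠ i := fun hji => hi' (hji ▸ hj)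
      intro x
      simp only [simple_eq, Equiv.swap_apply_def, lo, hi, Fin.ext_iff, Fin.le_def, ne_eq] at *
      split_ifs <;> simp <;> omega
    | one => simp
    | mul x y _ _ hx hy => intro z; rw [Equiv.Perm.mul_apply, hx, hy]
    | inv x _ hx => intro z; rw [← hx (x⁻¹ z)]; simp
  rw [mem_invSet] at hab
  have h1 := (key a).2 hai
  have h2 := mt (key b).1 (not_le.2 hib)
  exact h2 (hab.2.le.trans h1)

/-- The prescribed $g$ inverts every pair that an element of the parabolic subgroup can invert:
those with all intermediate cuts in $S$. -/
theorem w0_eq {S : Set (Fin (n - 1))} {g : Equiv.Perm (Fin n)}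
    (h : ∀ a b, a < b → (g b < g a ↔ ∀ i, a ≤ lo i → lo i < b → i ∈ S)) : w0 S = g := by
  refine longest_eq (mem_closure_of_invSet fun a b hab => ?_) ?_
  · rw [mem_invSet] at hab
    exact (h a b hab.1).1 hab.2
  · rintro v hv ⟨a, b⟩ hab
    have hlt := (mem_invSet.1 hab).1
    exact mem_invSet.2 ⟨hlt, (h a b hlt).2 fun i => invSet_of_mem_closure hv hab⟩

theorem mem_desR {i : Fin (n - 1)} {σ : Equiv.Perm (Fin n)} :
    i ∈ desR σ ↔ σ (hi i) < σ (lo i) := by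
  rw [desR_eq, mem_desL, inv_inv]

theorem apply_lt_of_desR {T : Set (Fin (n - 1))} {σ : Equiv.Perm (Fin n)} (h : desR σ ⊆ T) :
    ∀ a b, a < b → (∀ i, a ≤ lo i → lo i < b → i ∉ T) → σ a < σ b := by
  have key : ∀ d : ℕ, ∀ a b : Fin n, b.1 = a.1 + d + 1 →
      (∀ i, a ≤ lo i → lo i < b → i ∉ T) → σ a < σ b := by
    intro d
    induction d with
    | zero =>
      intro a b hb hT
      have h1 : (⟨a.1, by omega⟩ : Fin (n - 1)) ∉ desR σ := fun h1 =>
        hT _ le_rfl (by rw [Fin.lt_def, lo_val]; simp only; omega) (h h1)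
      rw [desR_eq, notMem_desL, inv_inv] at h1
      have hb' : hi ⟨a.1, by omega⟩ = b := Fin.ext (by rw [hi_val]; simp only; omega)
      rwa [hb'] at h1
    | succ d ih =>
      intro a b hb hT
      refine (ih a ⟨a.1 + d + 1, by omega⟩ rfl fun i h1 h2 => hT i h1 (h2.trans ?_)).trans ?_
      · rw [Fin.lt_def]; simp only; omega
      have h1 : (⟨a.1 + d + 1, by omega⟩ : Fin (n - 1)) ∉ desR σ := fun h1 =>
        hT _ (by rw [Fin.le_def, lo_val]; simp only; omega)
          (by rw [Fin.lt_def, lo_val]; simp only; omega) (h h1)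
      rw [desR_eq, notMem_desL, inv_inv] at h1
      have hb' : hi ⟨a.1 + d + 1, by omega⟩ = b := Fin.ext (by rw [hi_val]; simp only; omega)
      rwa [hb'] at h1
  intro a b hab
  rw [Fin.lt_def] at hab
  exact key (b.1 - a.1 - 1) a b (by omega)

/-- If no cut between two positions lies in $T$, a permutation with right descents in $T$ increases
between them; $g$ inverts all other pairs. -/
theorem w1_eq {T : Set (Fin (n - 1))} {g : Equiv.Perm (Fin n)}
    (h : ∀ a b, a < b → (g b < g a ↔ ∃ i, a ≤ lo i ∧ lo i < b ∧ i ∈ T)) : w1 T = g := by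
  refine longest_eq (A := {z | desR z ⊆ T}) ?_ ?_
  · intro i hi'
    obtain ⟨j, h1, h2, h3⟩ := (h _ _ (lo_lt_hi i)).1 (mem_desR.1 hi')
    have : j = i := by
      simp only [lo_val, hi_val, Fin.le_def, Fin.lt_def, Fin.ext_iff] at *
      omega
    rwa [← this]
  · rintro v hv ⟨a, b⟩ hab
    rw [mem_invSet] at hab
    refine mem_invSet.2 ⟨hab.1, (h a b hab.1).2 ?_⟩
    by_contra! hcon
    exact absurd (apply_lt_of_desR hv a b hab.1 hcon) hab.2.asymm

/-! ### Rigidity of descent-preserving isomorphisms -/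

/-- A simple transposition that creates the descent `i` is `s_i`. -/
theorem eq_of_mem_desL_simple_mul {i j : Fin (n - 1)} {σ : Equiv.Perm (Fin n)} (hj : j ∉ desL σ)
    (hi' : i ∉ desL σ) (h : i ∈ desL (simple j * σ)) : j = i := by
  by_contra hne
  rw [notMem_desL] at hj hi'
  rw [mem_desL] at h
  simp only [mul_inv_rev, simple_inv, Equiv.Perm.mul_apply] at h
  have hne' : i.1 ≠ j.1 := fun h => hne (Fin.ext h.symm)
  have e1 : hi j = lo i → simple j (lo i) = lo j := by rintro h; rw [← h, simple_hi]
  have e2 : lo j = hi i → simple j (hi i) = hi j := by rintro h; rw [← h, simple_lo]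
  have e3 : hi j ≠ lo i → simple j (lo i) = lo i := fun h =>
    Equiv.swap_apply_of_ne_of_ne (by simp [lo, Fin.ext_iff, hne']) (Ne.symm h)
  have e4 : lo j ≠ hi i → simple j (hi i) = hi i := fun h =>
    Equiv.swap_apply_of_ne_of_ne (Ne.symm h) (by simp [hi, Fin.ext_iff, hne'])
  -- When $i$ and $j$ are adjacent, the two ascents before the swap order three consecutive letters,
  -- and transitivity keeps $i$ an ascent; otherwise $s_j$ moves neither letter.
  by_cases c1 : hi j = lo i
  · have c2 : lo j ≠ hi i := by
      intro c2
      simp only [hi, lo, Fin.ext_iff] at c1 c2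
      omega
    rw [e1 c1, e4 c2] at h
    rw [c1] at hj
    exact absurd h (hj.trans hi').asymm
  · rw [e3 c1] at h
    by_cases c2 : lo j = hi i
    · rw [e2 c2] at h
      rw [c2] at hj
      exact absurd h (hi'.trans hj).asymm
    · rw [e4 c2] at h
      exact absurd h hi'.asymm

theorem intervalL_left_unique {σ ρ σ' ρ' : Equiv.Perm (Fin n)} (h : leL σ ρ) (h' : leL σ' ρ')
    (he : intervalL σ ρ = intervalL σ' ρ') : σ = σ' := by
  have h1 : σ ∈ intervalL σ' ρ' := he ▸ ⟨leL_refl σ, h⟩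
  have h2 : σ' ∈ intervalL σ ρ := he ▸ ⟨leL_refl σ', h'⟩
  exact leL_antisymm h2.1 h1.1

/-- An interval determines its bottom, so the endpoints quantified in `classLE` may be replaced by
the given ones. -/
theorem classLE_iff {σ ρ σ' ρ' : Equiv.Perm (Fin n)} (h : leL σ ρ) (h' : leL σ' ρ') :
    classLE (intervalL σ ρ) (intervalL σ' ρ') ↔ leR σ σ' := by
  constructor
  · rintro ⟨a, b, c, d, hab, e1, hcd, e2, hac⟩
    rwa [intervalL_left_unique h hab e1, intervalL_left_unique h' hcd e2]
  · intro hle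
    exact ⟨σ, ρ, σ', ρ', h, rfl, h', rfl, hle⟩

/-- A descent-preserving isomorphism of left weak Bruhat intervals is a right translation. -/
theorem DescentEquiv.eq_mul {σ ρ : Equiv.Perm (Fin n)} {J : Set (Equiv.Perm (Fin n))}
    (hle : leL σ ρ) (hJ : IsInterval J) (f : intervalL σ ρ ≃ J)
    (hf : ∀ a b : intervalL σ ρ, leL a.1 b.1 ↔ leL (f a).1 (f b).1)
    (hd : ∀ a : intervalL σ ρ, desL a.1 = desL (f a).1) :
    ∃ π : Equiv.Perm (Fin n), ∀ a : intervalL σ ρ, (f a).1 = a.1 * π := by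
  obtain ⟨σ', ρ', -, rfl⟩ := hJ
  let s : intervalL σ ρ := ⟨σ, leL_refl σ, hle⟩
  -- The value at the bottom $\sigma$ dictates the translation; the formula is then propagated
  -- upwards along covers.
  refine ⟨σ⁻¹ * (f s).1, ?_⟩
  suffices H : ∀ γ, leL σ γ → ∀ hγ : γ ∈ intervalL σ ρ,
      (f ⟨γ, hγ⟩).1 = γ * (σ⁻¹ * (f s).1) from fun a => H a.1 a.2.1 a.2
  intro γ hγ
  induction hγ with
  | refl => intro hγ; rw [← mul_assoc]; simp [s]
  | @tail γ δ h1 hs ih =>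
    intro hδ
    obtain ⟨i, hi, rfl⟩ := hs
    have hle1 : leL γ (simple i * γ) := Relation.ReflTransGen.single ⟨i, hi, rfl⟩
    have hγ : γ ∈ intervalL σ ρ := ⟨h1, leL_trans hle1 hδ.2⟩
    have hfle := (hf ⟨γ, hγ⟩ ⟨_, hδ⟩).1 hle1
    have hneq : (f ⟨γ, hγ⟩).1 ≠ (f ⟨_, hδ⟩).1 := by
      intro he
      have := congrArg Subtype.val (f.injective (Subtype.ext he))
      simp only at this
      have h2 := card_invSet_simple_mul (notMem_desL.1 hi)
      rw [← this] at h2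
      omega
    -- Let $s_j$ be the first step from $f(\gamma)$ towards $f(s_i\gamma)$. The preimage of
    -- $s_jf(\gamma)$ lies above $\gamma$ and below $s_i\gamma$; as the latter covers $\gamma$, it
    -- is $s_i\gamma$. The new descent $i$ then forces $j=i$.
    rcases Relation.ReflTransGen.cases_head hfle with he | ⟨c, ⟨j, hj, rfl⟩, hc⟩
    · exact absurd he hneq
    have hcJ : simple j * (f ⟨γ, hγ⟩).1 ∈ intervalL σ' ρ' :=
      ⟨leL_trans (f ⟨γ, hγ⟩).2.1 (Relation.ReflTransGen.single ⟨j, hj, rfl⟩),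
        leL_trans hc (f ⟨_, hδ⟩).2.2⟩
    obtain ⟨ε, hε⟩ := f.surjective ⟨_, hcJ⟩
    have e1 : leL γ ε.1 := (hf ⟨γ, hγ⟩ ε).2 (by
      rw [hε]; exact Relation.ReflTransGen.single ⟨j, hj, rfl⟩)
    have e2 : leL ε.1 (simple i * γ) := (hf ε ⟨_, hδ⟩).2 (by rw [hε]; exact hc)
    have e3 : γ ≠ ε.1 := by
      intro he
      have h3 : f ⟨γ, hγ⟩ = ⟨_, hcJ⟩ := by rw [← hε]; congr 1; exact Subtype.ext he
      have h4 := card_invSet_simple_mul (notMem_desL.1 hj)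
      have h5 : (f ⟨γ, hγ⟩).1 = simple j * (f ⟨γ, hγ⟩).1 := congrArg Subtype.val h3
      rw [← h5] at h4
      omega
    have e4 : ε.1 = simple i * γ := by
      refine invSet_ext (Finset.eq_of_subset_of_card_le (leL_iff.1 e2) ?_)
      rw [card_invSet_simple_mul (notMem_desL.1 hi)]
      refine Finset.card_lt_card (Finset.ssubset_iff_subset_ne.2 ⟨leL_iff.1 e1, fun he => ?_⟩)
      exact e3 (invSet_ext he)
    have e5 : (f ⟨_, hδ⟩).1 = simple j * (f ⟨γ, hγ⟩).1 := by
      have h3 : (f ε).1 = simple j * (f ⟨γ, hγ⟩).1 := congrArg Subtype.val hε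
      rw [← h3]
      congr 2
      exact Subtype.ext e4.symm
    have hij : j = i := by
      refine eq_of_mem_desL_simple_mul hj ?_ ?_
      · rw [← hd]; exact hi
      · rw [← e5, ← hd, mem_desL]
        have := notMem_desL.1 hi
        simpa [mul_inv_rev] using this
    rw [e5, hij, ih hγ, mul_assoc]

end SymmetricGroup

/-! ### Reading words of fillings -/

section Fillings

variable {n : ℕ} {D : Finset Box}

theorem orderFilling_lt_iff (h : D.card = n) (key : D → ℤ ×ₗ ℤ) (hk : Function.Injective key)
    {a b : D} : orderFilling h key hk a < orderFilling h key hk b ↔ key a < key b := by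
  constructor
  · intro hlt
    rcases lt_trichotomy (key a) (key b) with h1 | h1 | h1
    · exact h1
    · rw [hk h1] at hlt
      exact absurd hlt (lt_irrefl _)
    · exact absurd hlt (not_lt.2 (le_of_lt (card_key_lt_strictMono key h1)))
  · exact fun h1 => card_key_lt_strictMono key h1

theorem columnTableau_lt_iff (h : D.card = n) {a b : D} :
    (columnTableau h : Filling n D) a < columnTableau h b ↔
      a.1.1 < b.1.1 ∨ a.1.1 = b.1.1 ∧ a.1.2 < b.1.2 := by
  rw [columnTableau, orderFilling_lt_iff, keyBTLR, keyBTLR, Prod.Lex.toLex_lt_toLex]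
  simp

/-- The filling by rows, left to right, from the bottom row. -/
noncomputable def rowTableau (h : D.card = n) : Filling n D :=
  orderFilling h keyLRBT keyLRBT_injective

theorem rowTableau_lt_iff (h : D.card = n) {a b : D} :
    (rowTableau h : Filling n D) a < rowTableau h b ↔
      a.1.2 < b.1.2 ∨ a.1.2 = b.1.2 ∧ a.1.1 < b.1.1 := by
  rw [rowTableau, orderFilling_lt_iff, keyLRBT, keyLRBT, Prod.Lex.toLex_lt_toLex]
  simp

theorem orderFilling_keyTBLR_lt_iff (h : D.card = n) {a b : D} :
    (orderFilling h keyTBLR keyTBLR_injective : Filling n D) a <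
      orderFilling h keyTBLR keyTBLR_injective b ↔
      a.1.1 < b.1.1 ∨ a.1.1 = b.1.1 ∧ b.1.2 < a.1.2 := by
  rw [orderFilling_lt_iff, keyTBLR, keyTBLR, Prod.Lex.toLex_lt_toLex]
  simp

theorem orderFilling_keyLRTB_lt_iff (h : D.card = n) {a b : D} :
    (orderFilling h keyLRTB keyLRTB_injective : Filling n D) a <
      orderFilling h keyLRTB keyLRTB_injective b ↔
      b.1.2 < a.1.2 ∨ a.1.2 = b.1.2 ∧ a.1.1 < b.1.1 := by
  rw [orderFilling_lt_iff, keyLRTB, keyLRTB, Prod.Lex.toLex_lt_toLex]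
  simp

theorem orderFilling_keyRLBT_lt_iff (h : D.card = n) {a b : D} :
    (orderFilling h keyRLBT keyRLBT_injective : Filling n D) a <
      orderFilling h keyRLBT keyRLBT_injective b ↔
      a.1.2 < b.1.2 ∨ a.1.2 = b.1.2 ∧ b.1.1 < a.1.1 := by
  rw [orderFilling_lt_iff, keyRLBT, keyRLBT, Prod.Lex.toLex_lt_toLex]
  simp

theorem Filling.lt_of_le (F : Filling n D) {a b : D} (h : F a ≤ F b) (hne : a ≠ b) : F a < F b :=
  lt_of_le_of_ne h fun he => hne (F.injective he)

theorem readAlong_apply (R F : Filling n D) (a : D) : readAlong R F (R a) = F a := by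
  simp [readAlong]

theorem mem_invSet_readAlong (R F : Filling n D) (a b : D) :
    (R a, R b) ∈ invSet (readAlong R F) ↔ R a < R b ∧ F b < F a := by
  rw [mem_invSet, readAlong_apply, readAlong_apply]

theorem leL_readAlong {R F G : Filling n D} :
    leL (readAlong R F) (readAlong R G) ↔ ∀ a b, R a < R b → F b < F a → G b < G a := by
  rw [leL_iff]
  constructor
  · intro h a b h1 h2
    exact ((mem_invSet_readAlong R G a b).1 (h ((mem_invSet_readAlong R F a b).2 ⟨h1, h2⟩))).2
  · rintro h ⟨p, q⟩ hpq
    obtain ⟨a, rfl⟩ := R.surjective p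
    obtain ⟨b, rfl⟩ := R.surjective q
    rw [mem_invSet_readAlong] at hpq ⊢
    exact ⟨hpq.1, h a b hpq.1 hpq.2⟩

/-- The word of $G$ along $F$ has no inversions, like the word of $F$ along itself, and inversions
determine a permutation. -/
theorem Filling.ext_of_lt {F G : Filling n D} (h : ∀ a b, F a < F b → G a < G b) : F = G := by
  have h1 : invSet (readAlong F G) = invSet (readAlong F F) := by
    ext ⟨p, q⟩
    obtain ⟨a, rfl⟩ := F.surjective p
    obtain ⟨b, rfl⟩ := F.surjective q
    simp only [mem_invSet_readAlong]
    constructor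
    · rintro ⟨h1, h2⟩
      exact absurd h2 (h a b h1).asymm
    · rintro ⟨h1, h2⟩
      exact absurd h2 h1.asymm
  have h2 := invSet_ext h1
  ext a
  rw [← readAlong_apply F F a, ← readAlong_apply F G a, h2]

theorem mem_desL_readAlong {R F : Filling n D} {i : Fin (n - 1)} :
    i ∈ desL (readAlong R F) ↔ R (F.symm (hi i)) < R (F.symm (lo i)) := by
  rw [mem_desL]; rfl

/-- Composing $\mathrm{read}_R(F)$ with $R$ gives $F$, so compatibility with $P_R$ is exactly
standardness of $F$. -/
theorem mem_sigmaL_fillingPoset {R F : Filling n D} :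
    readAlong R F ∈ sigmaL (fillingPoset R) ↔ F ∈ stdTableaux n D := by
  constructor
  · intro h a b h1 h2
    have := h (R a) (R b) (by
      change (R.symm (R a) : Box) ≤ R.symm (R b)
      rw [Equiv.symm_apply_apply, Equiv.symm_apply_apply]
      exact ⟨h1, h2⟩)
    rwa [readAlong_apply, readAlong_apply] at this
  · intro h p q hpq
    obtain ⟨a, rfl⟩ := R.surjective p
    obtain ⟨b, rfl⟩ := R.surjective q
    rw [readAlong_apply, readAlong_apply]
    change (R.symm (R a) : Box) ≤ R.symm (R b) at hpq
    simp only [Equiv.symm_apply_apply] at hpq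
    exact h a b hpq.1 hpq.2

theorem exists_readAlong (R : Filling n D) (σ : Equiv.Perm (Fin n)) :
    ∃ F : Filling n D, readAlong R F = σ :=
  ⟨R.trans σ, by ext; simp [readAlong]⟩

theorem readAlong_left_injective (R : Filling n D) : Function.Injective (readAlong R) := by
  intro F G h
  ext a
  rw [← readAlong_apply R F, ← readAlong_apply R G, h]

theorem sigmaL_fillingPoset (R : Filling n D) :
    sigmaL (fillingPoset R) = readAlong R '' stdTableaux n D := by
  ext σ
  obtain ⟨F, rfl⟩ := exists_readAlong R σ
  rw [mem_sigmaL_fillingPoset]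
  exact ((readAlong_left_injective R).mem_set_image).symm

/-- The reading words of the standard tableaux. -/
noncomputable def tableauEquiv (R : Filling n D) :
    stdTableaux n D ≃ sigmaL (fillingPoset R) :=
  Equiv.ofBijective (fun τ => ⟨readAlong R τ.1, mem_sigmaL_fillingPoset.2 τ.2⟩) <| by
    constructor
    · intro F G h
      exact Subtype.ext (readAlong_left_injective R (congrArg Subtype.val h))
    · rintro ⟨σ, hσ⟩
      obtain ⟨F, rfl⟩ := exists_readAlong R σ
      exact ⟨⟨F, mem_sigmaL_fillingPoset.1 hσ⟩, rfl⟩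

/-! ### Anti-tableaux and their intervals -/

/-- Fillings whose entries increase along rows from left to right and along columns from top to
bottom. -/
def IsAntiTableau (R : Filling n D) : Prop :=
  ∀ a b : D, a.1.1 ≤ b.1.1 → b.1.2 ≤ a.1.2 → R a ≤ R b

theorem box_ext {a b : D} (h1 : a.1.1 = b.1.1) (h2 : a.1.2 = b.1.2) : a = b :=
  Subtype.ext (Prod.ext h1 h2)

theorem IsAntiTableau.lt {R : Filling n D} (hR : IsAntiTableau R) {a b : D} (h1 : a.1.1 ≤ b.1.1)
    (h2 : b.1.2 ≤ a.1.2) (hne : a ≠ b) : R a < R b := R.lt_of_le (hR a b h1 h2) hne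

theorem columnTableau_mem (h : D.card = n) : columnTableau h ∈ stdTableaux n D := by
  intro a b h1 h2
  rw [← not_lt, columnTableau_lt_iff]
  omega

theorem rowTableau_mem (h : D.card = n) : rowTableau h ∈ stdTableaux n D := by
  intro a b h1 h2
  rw [← not_lt, rowTableau_lt_iff]
  omega

/-- Let $a$ precede $b$ in $R$ while the column tableau puts $b$ first. Then $b$ cannot be left of
and above $a$, so it is weakly left of and below $a$, and every standard tableau inverts the pair.
-/
theorem leL_columnTableau (h : D.card = n) {R τ : Filling n D} (hR : IsAntiTableau R)
    (hτ : τ ∈ stdTableaux n D) : leL (readAlong R (columnTableau h)) (readAlong R τ) := by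
  rw [leL_readAlong]
  intro a b h1 h2
  rw [columnTableau_lt_iff] at h2
  have hne : b ≠ a := by rintro rfl; exact absurd h1 (lt_irrefl _)
  by_cases h3 : b.1.2 ≤ a.1.2
  · exact τ.lt_of_le (hτ b a (by omega) h3) hne
  · exact absurd h1 (not_lt.2 (hR b a (by omega) (by omega)))

theorem leL_rowTableau (h : D.card = n) {R τ : Filling n D} (hR : IsAntiTableau R)
    (hτ : τ ∈ stdTableaux n D) : leL (readAlong R τ) (readAlong R (rowTableau h)) := by
  rw [leL_readAlong]
  intro a b h1 h2
  rw [rowTableau_lt_iff]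
  by_contra hcon
  by_cases h3 : a.1.1 ≤ b.1.1
  · exact absurd h2 (not_lt.2 (hτ a b h3 (by omega)))
  · exact absurd h1 (not_lt.2 (hR b a (by omega) (by omega)))

/-- For comparable boxes the row and the column tableau agree. According to the order of the two
boxes in $R$, the upper bound forbids a wrong inversion or the lower bound imposes the right one. -/
theorem mem_stdTableaux_of_leL (h : D.card = n) {R τ : Filling n D}
    (h1 : leL (readAlong R (columnTableau h)) (readAlong R τ))
    (h2 : leL (readAlong R τ) (readAlong R (rowTableau h))) : τ ∈ stdTableaux n D := by
  rw [leL_readAlong] at h1 h2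
  intro a b hx hy
  by_contra! hlt
  have hne : a ≠ b := by rintro rfl; exact absurd hlt (lt_irrefl _)
  rcases lt_or_gt_of_ne (fun he => hne (R.injective he)) with hR | hR
  · have := h2 a b hR hlt
    rw [rowTableau_lt_iff] at this
    omega
  · refine absurd hlt (h1 b a hR ?_).asymm
    have : ¬ (a.1.1 = b.1.1 ∧ a.1.2 = b.1.2) := fun h => hne (box_ext h.1 h.2)
    rw [columnTableau_lt_iff]
    omega

theorem sigmaL_eq_intervalL (h : D.card = n) {R : Filling n D} (hR : IsAntiTableau R) :
    sigmaL (fillingPoset R) =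
      intervalL (readAlong R (columnTableau h)) (readAlong R (rowTableau h)) := by
  ext σ
  obtain ⟨τ, rfl⟩ := exists_readAlong R σ
  rw [mem_sigmaL_fillingPoset]
  exact ⟨fun hτ => ⟨leL_columnTableau h hR hτ, leL_rowTableau h hR hτ⟩,
    fun hτ => mem_stdTableaux_of_leL h hτ.1 hτ.2⟩

theorem leL_columnTableau_rowTableau (h : D.card = n) {R : Filling n D} (hR : IsAntiTableau R) :
    leL (readAlong R (columnTableau h)) (readAlong R (rowTableau h)) :=
  leL_columnTableau h hR (rowTableau_mem h)

/-- Only boxes in north-west to south-east position are free to be inverted, and every anti-tableau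
reads those in the same order. The criterion no longer mentions $R$. -/
theorem leL_readAlong_iff {R τ υ : Filling n D} (hR : IsAntiTableau R)
    (hυ : υ ∈ stdTableaux n D) (hτ : τ ∈ stdTableaux n D) :
    leL (readAlong R τ) (readAlong R υ) ↔
      ∀ a b : D, a.1.1 < b.1.1 → b.1.2 < a.1.2 → τ b < τ a → υ b < υ a := by
  rw [leL_readAlong]
  constructor
  · intro h a b h1 h2
    exact h a b (hR.lt h1.le h2.le (by rintro rfl; omega))
  · intro h a b h1 h2
    have hne : b ≠ a := by rintro rfl; exact absurd h1 (lt_irrefl _)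
    by_cases h3 : b.1.1 ≤ a.1.1 ∧ b.1.2 ≤ a.1.2
    · exact υ.lt_of_le (hυ b a h3.1 h3.2) hne
    by_cases h4 : a.1.1 ≤ b.1.1 ∧ a.1.2 ≤ b.1.2
    · exact absurd h2 (not_lt.2 (hτ a b h4.1 h4.2))
    by_cases h5 : a.1.1 < b.1.1
    · exact h a b h5 (by omega) h2
    · exact absurd h1 (not_lt.2 (hR b a (by omega) (by omega)))

theorem eq_lo_or_eq_hi {i : Fin (n - 1)} {x : Fin n} : lo i ≤ x → x ≤ hi i → x = lo i ∨ x = hi i := by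
  simp only [Fin.le_def, Fin.ext_iff, lo_val, hi_val]
  omega

/-- Freeness makes descents independent of $R$: if $i+1$ were strictly right of and above $i$, a
third box between them would need an entry strictly between $i$ and $i+1$. In all other positions
$R$ is determined by being an anti-tableau. -/
theorem mem_desL_readAlong_iff (hf : IsFree D) {R τ : Filling n D} (hR : IsAntiTableau R)
    (hτ : τ ∈ stdTableaux n D) {i : Fin (n - 1)} :
    i ∈ desL (readAlong R τ) ↔ (τ.symm (hi i)).1.1 ≤ (τ.symm (lo i)).1.1 := by
  rw [mem_desL_readAlong]
  obtain ⟨a, ha⟩ : ∃ a, a = τ.symm (lo i) := ⟨_, rfl⟩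
  obtain ⟨b, hb⟩ : ∃ b, b = τ.symm (hi i) := ⟨_, rfl⟩
  have ha' : τ a = lo i := by simp [ha]
  have hb' : τ b = hi i := by simp [hb]
  rw [← ha, ← hb]
  have hlt : τ a < τ b := by rw [ha', hb']; exact lo_lt_hi i
  have hne : a ≠ b := by rintro rfl; exact absurd hlt (lt_irrefl _)
  constructor
  · intro h
    by_contra! hcol
    by_cases h2 : b.1.2 ≤ a.1.2
    · exact absurd h (hR.lt hcol.le h2 hne).asymm
    · refine hf a.1 b.1 ⟨a.2, b.2, hcol, by omega, ?_⟩
      intro c hc h3 h4 h5 h6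
      have e1 : τ a ≤ τ ⟨c, hc⟩ := hτ a ⟨c, hc⟩ h3 h5
      have e2 : τ ⟨c, hc⟩ ≤ τ b := hτ ⟨c, hc⟩ b h4 h6
      rw [ha'] at e1
      rw [hb'] at e2
      rcases eq_lo_or_eq_hi e1 e2 with e | e
      · left; rw [← ha'] at e; exact congrArg Subtype.val (τ.injective e)
      · right; rw [← hb'] at e; exact congrArg Subtype.val (τ.injective e)
  · intro h
    by_cases h2 : a.1.2 ≤ b.1.2
    · exact hR.lt h h2 hne.symm
    · exact absurd hlt (not_lt.2 (hτ b a h (by omega)))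

theorem descentEquiv_of_isAntiTableau (hf : IsFree D) {R R' : Filling n D} (hR : IsAntiTableau R)
    (hR' : IsAntiTableau R') : DescentEquiv (sigmaL (fillingPoset R)) (sigmaL (fillingPoset R')) := by
  refine ⟨(tableauEquiv R).symm.trans (tableauEquiv R'), ?_, ?_⟩
  · intro x y
    obtain ⟨⟨τ, hτ⟩, rfl⟩ := (tableauEquiv R).surjective x
    obtain ⟨⟨υ, hυ⟩, rfl⟩ := (tableauEquiv R).surjective y
    simp only [Equiv.trans_apply, Equiv.symm_apply_apply]
    exact (leL_readAlong_iff hR hυ hτ).trans (leL_readAlong_iff hR' hυ hτ).symm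
  · intro x
    obtain ⟨⟨τ, hτ⟩, rfl⟩ := (tableauEquiv R).surjective x
    simp only [Equiv.trans_apply, Equiv.symm_apply_apply]
    ext i
    exact (mem_desL_readAlong_iff hf hR hτ).trans (mem_desL_readAlong_iff hf hR' hτ).symm

/-- Two boxes with nothing in between are consecutive in a standard tableau. -/
theorem exists_tableau_consecutive (h : D.card = n) {a b : D}
    (hba : ¬ (b.1.1 ≤ a.1.1 ∧ b.1.2 ≤ a.1.2))
    (hbtw : ∀ c : D, a.1.1 ≤ c.1.1 → c.1.1 ≤ b.1.1 → a.1.2 ≤ c.1.2 → c.1.2 ≤ b.1.2 →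
      c = a ∨ c = b) :
    ∃ τ ∈ stdTableaux n D, ∃ i, τ.symm (lo i) = a ∧ τ.symm (hi i) = b := by
  classical
  have hne : a ≠ b := by rintro rfl; exact hba ⟨le_rfl, le_rfl⟩
  obtain ⟨le, hle⟩ : ∃ le : D → D → Prop, ∀ c d, le c d ↔ c.1.1 ≤ d.1.1 ∧ c.1.2 ≤ d.1.2 :=
    ⟨_, fun _ _ => Iff.rfl⟩
  rw [← hle] at hba
  replace hbtw : ∀ c, le a c → le c b → c = a ∨ c = b := fun c h1 h2 =>
    hbtw c ((hle _ _).1 h1).1 ((hle _ _).1 h2).1 ((hle _ _).1 h1).2 ((hle _ _).1 h2).2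
  have le_tr : ∀ {c d e}, le c d → le d e → le c e := fun {c d e} h1 h2 => by
    rw [hle] at *; omega
  have le_as : ∀ {c d}, le c d → le d c → c = d := fun {c d} h1 h2 => by
    rw [hle] at *; exact box_ext (by omega) (by omega)
  -- Fill first the remaining boxes below $a$ or $b$ in the box order, then $a$, then $b$, then the
  -- rest, breaking ties by the column tableau. The hypotheses on $a,b$ make these four classes
  -- compatible with the order.
  obtain ⟨cls, hcls0⟩ : ∃ cls : D → ℤ, ∀ c, cls c = if c = a then 1 else if c = b then 2 else
    if le c a ∨ le c b then 0 else 3 := ⟨_, fun _ => rfl⟩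
  let key : D → ℤ ×ₗ ℤ := fun c => toLex (cls c, ((columnTableau h c).1 : ℤ))
  have hk : Function.Injective key := by
    intro c d hcd
    have : ((columnTableau h c).1 : ℤ) = (columnTableau h d).1 :=
      congrArg (fun p => (ofLex p).2) hcd
    exact (columnTableau h).injective (Fin.ext (by exact_mod_cast this))
  have hcls : ∀ c d, le c d → cls c ≤ cls d := by
    intro c d hcd
    have f1 : d = a → c ≠ a → le c a := by rintro rfl _; exact hcd
    have f2 : d = a → c = b → False := by rintro rfl rfl; exact hba hcd
    have f3 : d = b → le c b := by rintro rfl; exact hcd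
    have f4 : c = a → d ≠ b → d ≠ a → ¬ le d a ∧ ¬ le d b := by
      rintro rfl h1 h2
      refine ⟨fun h3 => h2 (le_as h3 hcd), fun h3 => ?_⟩
      rcases hbtw d hcd h3 with h4 | h4
      · exact h2 h4
      · exact h1 h4
    have f5 : c = b → d ≠ b → d ≠ a → ¬ le d a ∧ ¬ le d b := by
      rintro rfl h1 h2
      exact ⟨fun h3 => hba (le_tr hcd h3), fun h3 => h1 (le_as h3 hcd)⟩
    have f6 : le d a ∨ le d b → le c a ∨ le c b := by
      rintro (h1 | h1)
      · exact Or.inl (le_tr hcd h1)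
      · exact Or.inr (le_tr hcd h1)
    rw [hcls0, hcls0]
    split_ifs <;> first | omega | (exfalso; grind)
  let τ : Filling n D := orderFilling h key hk
  have hτlt : ∀ c d, τ c < τ d ↔ cls c < cls d ∨ cls c = cls d ∧
      columnTableau h c < columnTableau h d := by
    intro c d
    rw [orderFilling_lt_iff, Prod.Lex.toLex_lt_toLex, Nat.cast_lt, Fin.lt_def]
  have ca : cls a = 1 := by rw [hcls0, if_pos rfl]
  have cb : cls b = 2 := by rw [hcls0, if_neg hne.symm, if_pos rfl]
  have c1 : ∀ c, cls c = 1 → c = a := by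
    intro c hc
    rw [hcls0] at hc
    split_ifs at hc <;> first | assumption | omega
  have c2 : ∀ c, cls c = 2 → c = b := by
    intro c hc
    rw [hcls0] at hc
    split_ifs at hc <;> first | assumption | omega
  have hab : τ a < τ b := (hτlt a b).2 (Or.inl (by omega))
  have hsucc : (τ b).1 = (τ a).1 + 1 := by
    by_contra hcon
    obtain ⟨c, hc⟩ := τ.surjective ⟨(τ a).1 + 1, by
      have := (τ b).2; rw [Fin.lt_def] at hab; omega⟩
    have h1 : τ a < τ c := by rw [hc, Fin.lt_def]; simp
    have h2 : τ c < τ b := by rw [hc, Fin.lt_def]; rw [Fin.lt_def] at hab; simp only; omega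
    rw [hτlt] at h1 h2
    have h3 : cls c = 1 ∨ cls c = 2 := by omega
    rcases h3 with h3 | h3
    · rw [c1 c h3] at h1; simp at h1
    · rw [c2 c h3] at h2; simp at h2
  refine ⟨τ, ?_, ⟨(τ a).1, by have := (τ b).2; omega⟩, ?_, ?_⟩
  · intro c d h1 h2
    rw [← not_lt, hτlt]
    have h3 := hcls c d ((hle c d).2 ⟨h1, h2⟩)
    have h4 := not_lt.2 (columnTableau_mem h c d h1 h2)
    rintro (h5 | h5)
    · omega
    · exact h4 h5.2
  · rw [Equiv.symm_apply_eq]; rfl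
  · rw [Equiv.symm_apply_eq]; exact Fin.ext hsucc.symm

/-- Two boxes that can carry $i$ and $i+1$ in some standard tableau are compared alike by $R$ and
$R'$, since that comparison is a descent. Every required inequality is such a comparison, or is
composed of shorter ones along a row or a column. -/
theorem isAntiTableau_of_desL_eq (h : D.card = n) {R R' : Filling n D} (hR : IsAntiTableau R)
    (hd : ∀ τ ∈ stdTableaux n D, desL (readAlong R τ) = desL (readAlong R' τ)) :
    IsAntiTableau R' := by
  have key : ∀ a b : D, ¬ (b.1.1 ≤ a.1.1 ∧ b.1.2 ≤ a.1.2) →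
      (∀ c : D, a.1.1 ≤ c.1.1 → c.1.1 ≤ b.1.1 → a.1.2 ≤ c.1.2 → c.1.2 ≤ b.1.2 →
        c = a ∨ c = b) → (R b < R a ↔ R' b < R' a) := by
    intro a b h1 h2
    obtain ⟨τ, hτ, i, rfl, rfl⟩ := exists_tableau_consecutive h h1 h2
    rw [← mem_desL_readAlong, ← mem_desL_readAlong, hd τ hτ]
  have main : ∀ k : ℕ, ∀ a b : D, b.1.1 - a.1.1 + (a.1.2 - b.1.2) = k → a.1.1 ≤ b.1.1 →
      b.1.2 ≤ a.1.2 → a ≠ b → R' a < R' b := by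
    intro k
    induction k using Nat.strong_induction_on with
    | _ k ih =>
    intro a b hk h1 h2 hne
    have hne' : ¬ (a.1.1 = b.1.1 ∧ a.1.2 = b.1.2) := fun h => hne (box_ext h.1 h.2)
    by_cases hc : (a.1.1 = b.1.1 ∨ a.1.2 = b.1.2) ∧ ∃ c : D, a.1.1 ≤ c.1.1 ∧ c.1.1 ≤ b.1.1 ∧
        b.1.2 ≤ c.1.2 ∧ c.1.2 ≤ a.1.2 ∧ c ≠ a ∧ c ≠ b
    · obtain ⟨hs, c, c1, c2, c3, c4, c5, c6⟩ := hc
      have d1 : ¬ (c.1.1 = a.1.1 ∧ c.1.2 = a.1.2) := fun h => c5 (box_ext h.1 h.2)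
      have d2 : ¬ (c.1.1 = b.1.1 ∧ c.1.2 = b.1.2) := fun h => c6 (box_ext h.1 h.2)
      exact (ih _ (by omega) a c rfl c1 c4 c5.symm).trans (ih _ (by omega) c b rfl c2 c3 c6)
    · by_cases hcol : a.1.1 = b.1.1
      · refine (key b a (by omega) ?_).1 (hR.lt h1 h2 hne)
        intro c e1 e2 e3 e4
        by_contra! hcon
        exact hc ⟨Or.inl hcol, c, by omega, by omega, e3, e4, hcon.2, hcon.1⟩
      -- If $b$ is strictly below $a$, the between-condition is vacuous; if they share a row, no box
      -- separates them.
      · have hlt := (key a b (by omega) ?_).not.1 (hR.lt h1 h2 hne).asymm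
        · exact R'.lt_of_le (not_lt.1 hlt) hne
        · intro c e1 e2 e3 e4
          by_contra! hcon
          exact hc ⟨Or.inr (by omega), c, by omega, by omega, by omega, by omega, hcon.1, hcon.2⟩
  intro a b h1 h2
  by_cases hne : a = b
  · rw [hne]
  · exact (main _ a b rfl h1 h2 hne).le

/-! ### The equivalence class, its order and its extreme elements -/

/-- The class of the interval of a filling of a diagram free of strictly upper-right pairs. -/
theorem eqClass_sigmaL (h : D.card = n) (hf : IsFree D) {R : Filling n D} (hR : IsAntiTableau R) :
    eqClass (sigmaL (fillingPoset R)) =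
      {I | ∃ R' : Filling n D, IsAntiTableau R' ∧ I = sigmaL (fillingPoset R')} := by
  ext J
  constructor
  · rintro ⟨hJ, hd⟩
    have hI := sigmaL_eq_intervalL h hR
    rw [hI] at hd
    obtain ⟨f, hf1, hf2⟩ := hd
    obtain ⟨π, hπ⟩ := DescentEquiv.eq_mul (leL_columnTableau_rowTableau h hR) hJ f hf1 hf2
    have hmem : ∀ τ ∈ stdTableaux n D, readAlong R τ ∈
        intervalL (readAlong R (columnTableau h)) (readAlong R (rowTableau h)) := by
      intro τ hτ
      rw [← hI]
      exact mem_sigmaL_fillingPoset.2 hτ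
    have hread : ∀ τ : Filling n D, readAlong (R.trans π⁻¹) τ = readAlong R τ * π := fun τ => rfl
    -- Right translation by $\pi$ amounts to relabelling the reading order by $\pi^{-1}$.
    refine ⟨R.trans π⁻¹, isAntiTableau_of_desL_eq h hR ?_, ?_⟩
    · intro τ hτ
      rw [hread, ← hπ ⟨_, hmem τ hτ⟩, ← hf2]
    · rw [sigmaL_fillingPoset]
      ext σ
      constructor
      · intro hσ
        obtain ⟨⟨γ, hγ⟩, hfγ⟩ := f.surjective ⟨σ, hσ⟩
        obtain ⟨τ, rfl⟩ := exists_readAlong R γ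
        refine ⟨τ, ?_, ?_⟩
        · rw [← hI] at hγ
          exact mem_sigmaL_fillingPoset.1 hγ
        · rw [hread, ← hπ ⟨_, hγ⟩, hfγ]
      · rintro ⟨τ, hτ, rfl⟩
        rw [hread, ← hπ ⟨_, hmem τ hτ⟩]
        exact (f _).2
  · rintro ⟨R', hR', rfl⟩
    exact ⟨⟨_, _, leL_columnTableau_rowTableau h hR', sigmaL_eq_intervalL h hR'⟩,
      descentEquiv_of_isAntiTableau hf hR hR'⟩

/-- Inverting a reading word exchanges the roles of the two fillings, and inversion turns
$\preceq_R$ into $\preceq_L$. -/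
theorem classLE_sigmaL_iff (h : D.card = n) {R R' : Filling n D} (hR : IsAntiTableau R)
    (hR' : IsAntiTableau R') : classLE (sigmaL (fillingPoset R)) (sigmaL (fillingPoset R')) ↔
      leL (readAlong (columnTableau h) R) (readAlong (columnTableau h) R') := by
  rw [sigmaL_eq_intervalL h hR, sigmaL_eq_intervalL h hR',
    classLE_iff (leL_columnTableau_rowTableau h hR) (leL_columnTableau_rowTableau h hR'), leR_iff]
  rfl

theorem sigmaL_fillingPoset_inj (h : D.card = n) {R R' : Filling n D} (hR : IsAntiTableau R)
    (hR' : IsAntiTableau R') (he : sigmaL (fillingPoset R) = sigmaL (fillingPoset R')) :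
    R = R' := by
  have h1 := (classLE_sigmaL_iff h hR hR').1
    ⟨_, _, _, _, leL_columnTableau_rowTableau h hR, sigmaL_eq_intervalL h hR,
      leL_columnTableau_rowTableau h hR, he ▸ sigmaL_eq_intervalL h hR, Relation.ReflTransGen.refl⟩
  have h2 := (classLE_sigmaL_iff h hR' hR).1
    ⟨_, _, _, _, leL_columnTableau_rowTableau h hR, he ▸ sigmaL_eq_intervalL h hR,
      leL_columnTableau_rowTableau h hR, sigmaL_eq_intervalL h hR, Relation.ReflTransGen.refl⟩
  exact readAlong_left_injective _ (leL_antisymm h1 h2)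

theorem isAntiTableau_keyTBLR (h : D.card = n) :
    IsAntiTableau (orderFilling h keyTBLR keyTBLR_injective : Filling n D) := by
  intro a b h1 h2
  rw [← not_lt, orderFilling_keyTBLR_lt_iff]
  omega

theorem isAntiTableau_keyLRTB (h : D.card = n) :
    IsAntiTableau (orderFilling h keyLRTB keyLRTB_injective : Filling n D) := by
  intro a b h1 h2
  rw [← not_lt, orderFilling_keyLRTB_lt_iff]
  omega

/-- Against the upward column order this filling inverts only pairs within a column, which every
anti-tableau inverts. -/
theorem isMinOf_keyTBLR (h : D.card = n) (hf : IsFree D) {R : Filling n D}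
    (hR : IsAntiTableau R) : IsMinOf (eqClass (sigmaL (fillingPoset R)))
      (sigmaL (fillingPoset (orderFilling h keyTBLR keyTBLR_injective : Filling n D))) := by
  rw [eqClass_sigmaL h hf hR]
  refine ⟨⟨_, isAntiTableau_keyTBLR h, rfl⟩, ?_⟩
  rintro _ ⟨R', hR', rfl⟩
  rw [classLE_sigmaL_iff h (isAntiTableau_keyTBLR h) hR', leL_readAlong]
  intro a b h1 h2
  rw [columnTableau_lt_iff] at h1
  rw [orderFilling_keyTBLR_lt_iff] at h2
  exact hR'.lt (by omega) (by omega) (by rintro rfl; omega)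

/-- Pairs left uninverted by this filling have their first box weakly left of and weakly above the
second, so no anti-tableau inverts them. -/
theorem isMaxOf_keyLRTB (h : D.card = n) (hf : IsFree D) {R : Filling n D}
    (hR : IsAntiTableau R) : IsMaxOf (eqClass (sigmaL (fillingPoset R)))
      (sigmaL (fillingPoset (orderFilling h keyLRTB keyLRTB_injective : Filling n D))) := by
  rw [eqClass_sigmaL h hf hR]
  refine ⟨⟨_, isAntiTableau_keyLRTB h, rfl⟩, ?_⟩
  rintro _ ⟨R', hR', rfl⟩
  rw [classLE_sigmaL_iff h hR' (isAntiTableau_keyLRTB h), leL_readAlong]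
  intro a b h1 h2
  rw [columnTableau_lt_iff] at h1
  rw [orderFilling_keyLRTB_lt_iff]
  by_contra hcon
  exact absurd h2 (not_lt.2 (hR' a b (by omega) (by omega)))

/-! ### Reflection -/

theorem unreflect_apply (T : Filling n (reflectX D)) (a : D) :
    unreflect T a = T (reflectEquiv D a) := rfl

theorem reflectEquiv_fst (a : D) : (reflectEquiv D a).1.1 = a.1.1 := rfl

theorem reflectEquiv_snd (a : D) : (reflectEquiv D a).1.2 = height D + 1 - a.1.2 := rfl

theorem le_height (a : D) : a.1.2 ≤ height D := Finset.le_sup (f := Prod.snd) a.2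

theorem mem_stdTableaux_reflectX {T : Filling n (reflectX D)} :
    T ∈ stdTableaux n (reflectX D) ↔ IsAntiTableau (unreflect T) := by
  constructor
  · intro h a b h1 h2
    refine h _ _ h1 ?_
    rw [reflectEquiv_snd, reflectEquiv_snd]
    omega
  · intro h a b h1 h2
    obtain ⟨a, rfl⟩ := (reflectEquiv D).surjective a
    obtain ⟨b, rfl⟩ := (reflectEquiv D).surjective b
    refine h a b h1 ?_
    rw [reflectEquiv_snd, reflectEquiv_snd] at h2
    have := le_height a
    have := le_height b
    omega

theorem exists_unreflect (R : Filling n D) : ∃ T : Filling n (reflectX D), unreflect T = R :=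
  ⟨(reflectEquiv D).symm.trans R, by ext; simp [unreflect]⟩

theorem unreflect_injective : Function.Injective (unreflect (n := n) (D := D)) := by
  intro T U h
  ext a
  obtain ⟨a, rfl⟩ := (reflectEquiv D).surjective a
  rw [← unreflect_apply, ← unreflect_apply, h]

theorem unreflect_keyTBLR (h : D.card = n) (h' : (reflectX D).card = n) :
    unreflect (orderFilling h' keyTBLR keyTBLR_injective : Filling n (reflectX D)) =
      columnTableau h := by
  apply Filling.ext_of_lt
  intro a b hab
  rw [unreflect_apply, unreflect_apply, orderFilling_keyTBLR_lt_iff] at hab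
  rw [columnTableau_lt_iff]
  simp only [reflectEquiv_fst, reflectEquiv_snd] at hab
  omega

theorem readTBLR_reflect (h : D.card = n) (T : Filling n (reflectX D)) :
    readTBLR T = readAlong (columnTableau h) (unreflect T) := by
  rw [← unreflect_keyTBLR h T.card_eq]
  ext p
  simp [readTBLR, readAlong, unreflect]

theorem tableauLE_iff (h : D.card = n) {T U : Filling n (reflectX D)}
    (hT : T ∈ stdTableaux n (reflectX D)) (hU : U ∈ stdTableaux n (reflectX D)) :
    tableauLE T U ↔
      classLE (sigmaL (fillingPoset (unreflect T))) (sigmaL (fillingPoset (unreflect U))) := by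
  rw [classLE_sigmaL_iff h (mem_stdTableaux_reflectX.1 hT) (mem_stdTableaux_reflectX.1 hU),
    tableauLE, readTBLR_reflect h, readTBLR_reflect h]

theorem eqClass_sigmaL_eq_reflect (h : D.card = n) (hf : IsFree D) {R : Filling n D}
    (hR : IsAntiTableau R) : eqClass (sigmaL (fillingPoset R)) =
      {I | ∃ T ∈ stdTableaux n (reflectX D), I = sigmaL (fillingPoset (unreflect T))} := by
  rw [eqClass_sigmaL h hf hR]
  ext I
  constructor
  · rintro ⟨R', hR', rfl⟩
    obtain ⟨T, rfl⟩ := exists_unreflect R'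
    exact ⟨T, mem_stdTableaux_reflectX.2 hR', rfl⟩
  · rintro ⟨T, hT, rfl⟩
    exact ⟨unreflect T, mem_stdTableaux_reflectX.1 hT, rfl⟩

/-- The poset isomorphism from the tableaux on the reflected diagram to the class. -/
theorem exists_equiv_eqClass (h : D.card = n) (hf : IsFree D) {R : Filling n D}
    (hR : IsAntiTableau R) :
    ∃ Φ : stdTableaux n (reflectX D) ≃ eqClass (sigmaL (fillingPoset R)),
      (∀ T, (Φ T).1 = sigmaL (fillingPoset (unreflect T.1))) ∧
      ∀ T U, tableauLE T.1 U.1 ↔ classLE (Φ T).1 (Φ U).1 := by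
  have hC := eqClass_sigmaL_eq_reflect h hf hR
  refine ⟨Equiv.ofBijective (fun T => ⟨sigmaL (fillingPoset (unreflect T.1)), by
    rw [hC]; exact ⟨T.1, T.2, rfl⟩⟩) ⟨?_, ?_⟩, fun T => rfl, fun T U => tableauLE_iff h T.2 U.2⟩
  · intro T U he
    exact Subtype.ext (unreflect_injective (sigmaL_fillingPoset_inj h
      (mem_stdTableaux_reflectX.1 T.2) (mem_stdTableaux_reflectX.1 U.2)
      (congrArg Subtype.val he)))
  · rintro ⟨I, hI⟩
    have hI' := hI
    rw [hC] at hI'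
    obtain ⟨T, hT, rfl⟩ := hI'
    exact ⟨⟨T, hT⟩, rfl⟩

/-! ### Partial sums -/

theorem card_filter_attach (p : Box → Prop) [DecidablePred p] :
    ((Finset.univ : Finset D).filter fun b => p b.1).card = (D.filter p).card := by
  rw [← Finset.card_map (Function.Embedding.subtype _)]
  congr 1
  ext b
  simp only [Finset.mem_map, Finset.mem_filter, Finset.mem_univ, true_and,
    Function.Embedding.coe_subtype, Subtype.exists]
  exact ⟨fun ⟨c, hc, hp, he⟩ => he ▸ ⟨hc, hp⟩, fun ⟨hb, hp⟩ => ⟨b, hb, hp, rfl⟩⟩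

/-- When $R$ reads level by level, the boxes of level at most $k$ fill an initial segment of
positions. -/
theorem lt_card_filter_iff {R : Filling n D} {ρ : Box → ℕ}
    (hρ : ∀ a b : D, R a < R b → ρ a ≤ ρ b) (k : ℕ) (a : D) :
    (R a).1 < (D.filter fun b => ρ b ≤ k).card ↔ ρ a ≤ k := by
  rw [← card_filter_attach, ← Finset.card_map (R.toEmbedding)]
  constructor
  · intro h
    by_contra! hk
    have hsub : ((Finset.univ : Finset D).filter fun b => ρ b.1 ≤ k).map R.toEmbedding ⊆
        Finset.Iio (R a) := by
      intro p hp
      simp only [Finset.mem_map, Finset.mem_filter, Finset.mem_univ, true_and] at hp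
      obtain ⟨b, hb, rfl⟩ := hp
      rw [Finset.mem_Iio]
      by_contra! hle
      change R a ≤ R b at hle
      rcases hle.lt_or_eq with h1 | h1
      · have := hρ a b h1; omega
      · rw [R.injective h1] at hk; omega
    have := Finset.card_le_card hsub
    rw [Fin.card_Iio] at this
    omega
  · intro hk
    have hsub : Finset.Iic (R a) ⊆
        ((Finset.univ : Finset D).filter fun b => ρ b.1 ≤ k).map R.toEmbedding := by
      intro p hp
      rw [Finset.mem_Iic] at hp
      obtain ⟨b, rfl⟩ := R.surjective p
      refine Finset.mem_map.2 ⟨b, ?_, rfl⟩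
      simp only [Finset.mem_filter, Finset.mem_univ, true_and]
      rcases hp.lt_or_eq with h1 | h1
      · exact (hρ b a h1).trans hk
      · rwa [R.injective h1]
    have := Finset.card_le_card hsub
    rw [Fin.card_Iic] at this
    omega

/-- If the boxes are read by levels and the level sizes are `l`, then two positions are separated
by an element of `partialSums n l` iff their levels differ. -/
theorem exists_mem_partialSums_iff {R : Filling n D} {ρ : Box → ℕ} {l : List ℕ}
    (hρ : ∀ a b : D, R a < R b → ρ a ≤ ρ b)
    (hl : ∀ k, (l.take k).sum = (D.filter fun b => ρ b ≤ k).card) {a b : D} :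
    (∃ i, R a ≤ lo i ∧ lo i < R b ∧ i ∈ partialSums n l) ↔ ρ a < ρ b := by
  constructor
  · rintro ⟨i, h1, h2, k, hk⟩
    rw [hl] at hk
    rw [Fin.le_def, lo_val] at h1
    rw [Fin.lt_def, lo_val] at h2
    have h3 := (lt_card_filter_iff hρ k a).1 (by omega)
    have h4 := (lt_card_filter_iff hρ k b).not.1 (by omega)
    omega
  · intro h
    have h3 := (lt_card_filter_iff hρ (ρ a) a).2 le_rfl
    have h4 := (lt_card_filter_iff hρ (ρ a) b).not.2 (by omega)
    have h5 := (R b).2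
    -- The cut right after the last box of the level of $a$; the shift by one is the indexing of
    -- $[n-1]$ from zero.
    refine ⟨⟨(D.filter fun b => ρ b ≤ ρ a).card - 1, by omega⟩, ?_, ?_, ρ a, ?_⟩
    · rw [Fin.le_def, lo_val]; simp only; omega
    · rw [Fin.lt_def, lo_val]; simp only; omega
    · rw [hl]; simp only; omega

theorem take_rowLengths_sum (hpos : ∀ b ∈ D, 1 ≤ b.2) (k : ℕ) :
    ((rowLengths D).take k).sum = (D.filter fun b => height D + 1 - b.2 ≤ k).card := by
  have key : ∀ m, m ≤ height D →
      ((List.range m).map fun k => (D.filter fun b => b.2 = height D - k).card).sum =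
        (D.filter fun b => height D + 1 - b.2 ≤ m).card := by
    intro m
    induction m with
    | zero =>
      intro _
      symm
      simp only [List.range_zero, List.map_nil, List.sum_nil, Finset.card_eq_zero]
      refine Finset.filter_eq_empty_iff.2 fun b hb => ?_
      have := le_height ⟨b, hb⟩
      simp only at this
      omega
    | succ m ih =>
      intro hm
      rw [List.range_succ, List.map_append, List.sum_append, ih (by omega)]
      simp only [List.map_cons, List.map_nil, List.sum_cons, List.sum_nil, add_zero]
      rw [← Finset.card_union_of_disjoint]
      · congr 1
        ext b
        simp only [Finset.mem_union, Finset.mem_filter, ← and_or_left, and_congr_right_iff]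
        intro hb
        have := le_height ⟨b, hb⟩
        simp only at this
        omega
      · rw [Finset.disjoint_filter]
        intro b hb
        have := le_height ⟨b, hb⟩
        simp only at this
        omega
  rw [rowLengths, ← List.map_take, List.take_range, key _ (min_le_right _ _)]
  congr 1
  refine Finset.filter_congr fun b hb => ?_
  have := hpos b hb
  omega

/-- Read from the top row, the tableau filled from the bottom row inverts exactly the pairs in
different rows. -/
theorem w1_rowLengths (h : D.card = n) (hpos : ∀ b ∈ D, 1 ≤ b.2) :
    w1 (partialSums n (rowLengths D)) =
      readAlong (orderFilling h keyLRTB keyLRTB_injective) (rowTableau h) := by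
  apply w1_eq
  intro p q hpq
  obtain ⟨a, rfl⟩ := (orderFilling h keyLRTB keyLRTB_injective).surjective p
  obtain ⟨b, rfl⟩ := (orderFilling h keyLRTB keyLRTB_injective).surjective q
  rw [readAlong_apply, readAlong_apply,
    exists_mem_partialSums_iff (ρ := fun b => height D + 1 - b.2) ?_ (take_rowLengths_sum hpos),
    rowTableau_lt_iff]
  · rw [orderFilling_keyLRTB_lt_iff] at hpq
    have := le_height a
    have := le_height b
    omega
  · intro a b hab
    rw [orderFilling_keyLRTB_lt_iff] at hab
    omega

end Fillings

/-! ### Closed form of the algorithm: the index of the set containing a box -/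

section Algorithm

variable {n : ℕ} {α : Composition n}

theorem mem_cd {x y : ℕ} : (x, y) ∈ cd α ↔
    ∃ i : Fin α.length, y = i.1 + 1 ∧ 1 ≤ x ∧ x ≤ α.blocksFun i := by
  rw [cd, Finset.mem_map]
  constructor
  · rintro ⟨⟨i, j⟩, -, h⟩
    have h1 : j.1 + 1 = x := congrArg Prod.fst h
    have h2 : i.1 + 1 = y := congrArg Prod.snd h
    have := j.2
    exact ⟨i, h2.symm, by omega, by omega⟩
  · rintro ⟨i, h1, h2, h3⟩
    refine ⟨⟨i, ⟨x - 1, by omega⟩⟩, Finset.mem_univ _, Prod.ext ?_ h1.symm⟩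
    change x - 1 + 1 = x
    omega

theorem cd_left {x x' y : ℕ} (h : (x, y) ∈ cd α) (h1 : 1 ≤ x') (h2 : x' ≤ x) : (x', y) ∈ cd α := by
  rw [mem_cd] at h ⊢
  obtain ⟨i, hi, h3, h4⟩ := h
  exact ⟨i, hi, h1, h2.trans h4⟩

theorem cd_one {y : ℕ} : (1, y) ∈ cd α ↔ 1 ≤ y ∧ y ≤ α.length := by
  rw [mem_cd]
  constructor
  · rintro ⟨i, hi, -, -⟩
    have := i.2
    omega
  · intro h
    exact ⟨⟨y - 1, by omega⟩, by simp only; omega, le_rfl, α.one_le_blocksFun _⟩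

theorem cd_pos {x y : ℕ} (h : (x, y) ∈ cd α) : 1 ≤ x ∧ 1 ≤ y ∧ y ≤ α.length := by
  have hx : 1 ≤ x := by
    obtain ⟨i, -, h1, -⟩ := mem_cd.1 h
    exact h1
  exact ⟨hx, cd_one.1 (cd_left h le_rfl hx)⟩

theorem cd_le {x y : ℕ} (h : (x, y) ∈ cd α) : x ≤ n := by
  obtain ⟨i, -, -, h1⟩ := mem_cd.1 h
  exact h1.trans (α.blocksFun_le i)

theorem one_lt_card_rowX {y : ℕ} : 1 < (rowX α y).card ↔ (2, y) ∈ cd α := by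
  rw [Finset.one_lt_card]
  constructor
  · rintro ⟨⟨x, y1⟩, ha, ⟨x', y2⟩, hb, hne⟩
    simp only [rowX, Finset.mem_filter] at ha hb
    obtain ⟨ha, rfl⟩ := ha
    obtain ⟨hb, rfl⟩ := hb
    have h1 := (cd_pos ha).1
    have h2 := (cd_pos hb).1
    have h3 : x ≠ x' := by rintro rfl; exact hne rfl
    rcases lt_or_gt_of_ne h3 with h | h
    · exact cd_left hb (by omega) (by omega)
    · exact cd_left ha (by omega) (by omega)
  · intro h
    exact ⟨(1, y), by simpa [rowX] using cd_left h le_rfl (by omega), (2, y), by simpa [rowX] using h,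
      by simp⟩

theorem mem_BB_one {y : ℕ} :
    (1, y) ∈ BB α ↔ (1, y) ∈ cd α ∧ (y = α.length ∨ (2, y) ∈ cd α) := by
  simp only [BB, Finset.mem_filter, one_lt_card_rowX, lt_irrefl, false_and, or_false, true_and,
    and_congr_right_iff]
  intro h
  have := cd_pos h
  constructor
  · rintro (h1 | h1)
    · exact Or.inl h1
    · exact Or.inr h1.2
  · rintro (h1 | h1)
    · exact Or.inl h1
    · by_cases h2 : y = α.length
      · exact Or.inl h2
      · exact Or.inr ⟨by omega, h1⟩

/-- Rows are left-justified, so a higher box in column $k+1$ already gives one in column $k$. -/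
theorem mem_BB_succ {k y : ℕ} (hk : 1 ≤ k) :
    (k + 1, y) ∈ BB α ↔ (k + 1, y) ∈ cd α ∧ ∀ e, y < e → (k, e) ∉ cd α := by
  simp only [BB, Finset.mem_filter, and_congr_right_iff]
  intro h
  constructor
  · rintro (h1 | h1)
    · omega
    · intro e he hc
      exact h1.2 (k, e) hc (Or.inr rfl) he
  · intro h1
    refine Or.inr ⟨by omega, ?_⟩
    rintro ⟨x, e⟩ hc h2 h3
    simp only at h2 h3
    exact h1 e h3 (cd_left hc hk (by omega))

theorem BB_subset : BB α ⊆ cd α := Finset.filter_subset _ _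

variable (α) in
/-- The number of boxes of `BB(α)` in the first `k` columns. -/
def cntBB (k : ℕ) : ℕ := ((BB α).filter fun κ => κ.1 ≤ k).card

open Classical in
variable (α) in
/-- The index, counted from `0`, of the set `Y_j` containing the box in a given column and row:
from the second column on, a box lies in the same set as its successor, that is, the next box above
its row in the preceding column. -/
noncomputable def yIdx : ℕ → ℕ → ℕ
  | 0, _ => 0
  | 1, e => ((BB α).filter fun κ => κ.1 = 1 ∧ κ.2 < e).card
  | k + 2, e => if h : ∃ e', e < e' ∧ (k + 1, e') ∈ cd α then yIdx (k + 1) (Nat.find h)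
      else cntBB α (k + 1)

theorem yIdx_one (e : ℕ) :
    yIdx α 1 e = ((BB α).filter fun κ => κ.1 = 1 ∧ κ.2 < e).card := by rw [yIdx]

/-- `s` is the row of the next box above row `e` in column `k`. -/
def IsNext (α : Composition n) (k e s : ℕ) : Prop :=
  e < s ∧ (k, s) ∈ cd α ∧ ∀ r, e < r → (k, r) ∈ cd α → s ≤ r

theorem exists_isNext {k e r : ℕ} (h : e < r) (hr : (k, r) ∈ cd α) : ∃ s, IsNext α k e s := by
  classical
  have hex : ∃ e', e < e' ∧ (k, e') ∈ cd α := ⟨r, h, hr⟩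
  exact ⟨Nat.find hex, (Nat.find_spec hex).1, (Nat.find_spec hex).2,
    fun r h1 h2 => Nat.find_min' hex ⟨h1, h2⟩⟩

theorem yIdx_of_isNext {k e s : ℕ} (hk : 1 ≤ k) (h : IsNext α k e s) :
    yIdx α (k + 1) e = yIdx α k s := by
  classical
  obtain ⟨k, rfl⟩ : ∃ m, k = m + 1 := ⟨k - 1, by omega⟩
  have hex : ∃ e', e < e' ∧ (k + 1, e') ∈ cd α := ⟨s, h.1, h.2.1⟩
  rw [yIdx, dif_pos hex]
  congr 1
  exact le_antisymm (Nat.find_min' hex ⟨h.1, h.2.1⟩)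
    (h.2.2 _ (Nat.find_spec hex).1 (Nat.find_spec hex).2)

theorem yIdx_of_top {k e : ℕ} (hk : 1 ≤ k) (h : ∀ r, e < r → (k, r) ∉ cd α) :
    yIdx α (k + 1) e = cntBB α k := by
  obtain ⟨k, rfl⟩ : ∃ m, k = m + 1 := ⟨k - 1, by omega⟩
  rw [yIdx, dif_neg]
  rintro ⟨r, h1, h2⟩
  exact h r h1 h2

theorem isNext_or_top (k e : ℕ) : (∃ s, IsNext α k e s) ∨ ∀ r, e < r → (k, r) ∉ cd α := by
  by_cases h : ∃ r, e < r ∧ (k, r) ∈ cd α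
  · obtain ⟨r, h1, h2⟩ := h
    exact Or.inl (exists_isNext h1 h2)
  · exact Or.inr fun r h1 h2 => h ⟨r, h1, h2⟩

theorem cntBB_mono {k k' : ℕ} (h : k ≤ k') : cntBB α k ≤ cntBB α k' := by
  refine Finset.card_le_card fun κ hκ => ?_
  simp only [Finset.mem_filter] at hκ ⊢
  exact ⟨hκ.1, hκ.2.trans h⟩

theorem cntBB_le (k : ℕ) : cntBB α k ≤ (BB α).card := Finset.card_filter_le _ _

/-- Ensures that a set opened in a later column gets an index larger than all those used so far. -/
theorem yIdx_lt_cntBB {k : ℕ} (hk : 1 ≤ k) : ∀ {e}, (k, e) ∈ cd α → yIdx α k e < cntBB α k := by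
  induction k, hk using Nat.le_induction with
  | base =>
    intro e he
    have hp := cd_pos he
    rw [yIdx_one]
    apply Finset.card_lt_card
    refine (Finset.ssubset_iff_of_subset fun κ hκ => ?_).2 ⟨(1, α.length), ?_, ?_⟩
    · simp only [Finset.mem_filter] at hκ ⊢
      exact ⟨hκ.1, hκ.2.1.le⟩
    · rw [Finset.mem_filter]
      exact ⟨mem_BB_one.2 ⟨cd_one.2 ⟨by omega, le_rfl⟩, Or.inl rfl⟩, le_rfl⟩
    · simp only [Finset.mem_filter, not_and, not_lt]
      omega
  | succ k hk ih =>
    intro e he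
    rcases isNext_or_top (α := α) k e with ⟨s, hs⟩ | htop
    · rw [yIdx_of_isNext hk hs]
      exact (ih hs.2.1).trans_le (cntBB_mono (by omega))
    · rw [yIdx_of_top hk htop]
      apply Finset.card_lt_card
      refine (Finset.ssubset_iff_of_subset fun κ hκ => ?_).2 ⟨(k + 1, e), ?_, ?_⟩
      · simp only [Finset.mem_filter] at hκ ⊢
        exact ⟨hκ.1, by omega⟩
      · rw [Finset.mem_filter]
        exact ⟨(mem_BB_succ hk).2 ⟨he, htop⟩, le_rfl⟩
      · simp

/-- Induction over columns: the successor of $(k+1,e)$ is at height at most $e'$, that of $(k+1,e')$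
is strictly higher or missing. Indices tie only in column 1, where rows of length one join the set
of a higher row; a box to the right excludes this, and that clause yields strictness in the next
column. -/
theorem yIdx_column {k : ℕ} (hk : 1 ≤ k) : ∀ {e e'}, e < e' → (k, e) ∈ cd α → (k, e') ∈ cd α →
    yIdx α k e ≤ yIdx α k e' ∧ (2 ≤ k ∨ (k + 1, e) ∈ cd α → yIdx α k e < yIdx α k e') := by
  induction k, hk using Nat.le_induction with
  | base =>
    intro e e' hlt he he'
    rw [yIdx_one, yIdx_one]
    have hsub : ((BB α).filter fun κ => κ.1 = 1 ∧ κ.2 < e) ⊆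
        (BB α).filter fun κ => κ.1 = 1 ∧ κ.2 < e' := by
      intro κ hκ
      simp only [Finset.mem_filter] at hκ ⊢
      exact ⟨hκ.1, hκ.2.1, hκ.2.2.trans hlt⟩
    refine ⟨Finset.card_le_card hsub, ?_⟩
    rintro (h | h)
    · omega
    · refine Finset.card_lt_card ((Finset.ssubset_iff_of_subset hsub).2 ⟨(1, e), ?_, ?_⟩)
      · rw [Finset.mem_filter]
        exact ⟨mem_BB_one.2 ⟨he, Or.inr h⟩, rfl, hlt⟩
      · simp
  | succ k hk ih =>
    intro e e' hlt he he'
    have hck := cd_left he hk (by omega : k ≤ k + 1)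
    have hck' := cd_left he' hk (by omega : k ≤ k + 1)
    obtain ⟨s, hs⟩ := exists_isNext hlt hck'
    have h1 : yIdx α k s ≤ yIdx α k e' := by
      rcases (hs.2.2 e' hlt hck').lt_or_eq with h | h
      · exact (ih h hs.2.1 hck').1
      · rw [h]
    have h2 : yIdx α k e' < yIdx α (k + 1) e' := by
      rcases isNext_or_top (α := α) k e' with ⟨s', hs'⟩ | htop
      · rw [yIdx_of_isNext hk hs']
        exact (ih hs'.1 hck' hs'.2.1).2 (Or.inr he')
      · rw [yIdx_of_top hk htop]
        exact yIdx_lt_cntBB hk hck'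
    rw [yIdx_of_isNext hk hs]
    exact ⟨by omega, fun _ => by omega⟩

theorem yIdx_column_le {k e e' : ℕ} (hlt : e ≤ e') (h : (k, e) ∈ cd α) (h' : (k, e') ∈ cd α) :
    yIdx α k e ≤ yIdx α k e' := by
  rcases hlt.lt_or_eq with hlt | rfl
  · exact (yIdx_column (cd_pos h).1 hlt h h').1
  · rfl

theorem yIdx_succ {k e : ℕ} (hk : 1 ≤ k) (h : (k + 1, e) ∈ cd α) :
    yIdx α k e < yIdx α (k + 1) e := by
  have hck := cd_left h hk (by omega : k ≤ k + 1)
  rcases isNext_or_top (α := α) k e with ⟨s, hs⟩ | htop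
  · rw [yIdx_of_isNext hk hs]
    exact (yIdx_column hk hs.1 hck hs.2.1).2 (Or.inr h)
  · rw [yIdx_of_top hk htop]
    exact yIdx_lt_cntBB hk hck

theorem yIdx_row {k k' e : ℕ} (hk : 1 ≤ k) (hlt : k < k') (h : (k', e) ∈ cd α) :
    yIdx α k e < yIdx α k' e := by
  induction k', hlt using Nat.le_induction with
  | base => exact yIdx_succ hk h
  | succ m hm ih =>
    exact (ih (cd_left h (by omega) (by omega))).trans (yIdx_succ (by omega) h)

theorem yIdx_row_le {k k' e : ℕ} (hk : 1 ≤ k) (hlt : k ≤ k') (h : (k', e) ∈ cd α) :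
    yIdx α k e ≤ yIdx α k' e := by
  rcases hlt.lt_or_eq with hlt | rfl
  · exact (yIdx_row hk hlt h).le
  · rfl

/-- The successor of $(k+1,j)$ is at or below $(k,i)$. This matches the relation produced by the
triple rule. -/
theorem yIdx_diag {k i j : ℕ} (h' : (k, i) ∈ cd α) (hji : j < i) :
    yIdx α (k + 1) j ≤ yIdx α k i := by
  obtain ⟨s, hs⟩ := exists_isNext hji h'
  rw [yIdx_of_isNext (cd_pos h').1 hs]
  exact yIdx_column_le (hs.2.2 i hji h') hs.2.1 h'

/-- Freeness of $\mathscr C$ in the coordinates of $\mathrm{cd}(\alpha)$. If $k<k'$, the box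
$(k,i')$ works. Otherwise the successor of $(k,i)$ works, or, if it is missing or above row $i'$,
monotonicity contradicts the inequality of indices. Column 1 needs a separate argument because
indices may tie there. -/
theorem exists_between {k i k' i' : ℕ} (ha : (k, i) ∈ cd α) (hb : (k', i') ∈ cd α) (hi : i < i')
    (hy : yIdx α k i < yIdx α k' i') :
    ∃ x y, (x, y) ∈ cd α ∧ i ≤ y ∧ y ≤ i' ∧ yIdx α k i ≤ yIdx α x y ∧
      yIdx α x y ≤ yIdx α k' i' ∧ (x, y) ≠ (k, i) ∧ (x, y) ≠ (k', i') := by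
  have hpa := cd_pos ha
  have hpb := cd_pos hb
  by_cases hkk : k < k'
  · have hc := cd_left hb hpa.1 hkk.le
    refine ⟨k, i', hc, hi.le, le_rfl, yIdx_column_le hi.le ha hc, yIdx_row_le hpa.1 hkk.le hb, ?_, ?_⟩
      <;> simp only [ne_eq, Prod.mk.injEq] <;> omega
  obtain ⟨m, rfl⟩ : ∃ m, k = m + 1 := ⟨k - 1, by omega⟩
  rcases Nat.eq_zero_or_pos m with rfl | hm
  · obtain rfl : k' = 1 := by omega
    simp only [zero_add] at *
    have hc : (1, i + 1) ∈ cd α := cd_one.2 (by omega)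
    by_cases hii : i + 1 = i'
    · subst hii
      have h2 : (2, i) ∈ cd α := by
        by_contra h2
        refine absurd hy (not_lt.2 ?_)
        rw [yIdx_one, yIdx_one]
        refine Finset.card_le_card ?_
        rintro ⟨x, y⟩ hκ
        simp only [Finset.mem_filter] at hκ ⊢
        obtain ⟨h3, rfl, h4⟩ := hκ
        refine ⟨h3, rfl, lt_of_le_of_ne (by omega) ?_⟩
        rintro rfl
        rcases (mem_BB_one.1 h3).2 with h5 | h5
        · omega
        · exact h2 h5
      have h3 : yIdx α 2 i = yIdx α 1 (i + 1) :=
        yIdx_of_isNext le_rfl ⟨by omega, hc, fun r hr _ => hr⟩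
      refine ⟨2, i, h2, le_rfl, by omega, by omega, h3.le, ?_, ?_⟩ <;>
        simp only [ne_eq, Prod.mk.injEq] <;> omega
    · refine ⟨1, i + 1, hc, by omega, by omega, yIdx_column_le (by omega) ha hc,
        yIdx_column_le (by omega) hc hb, ?_, ?_⟩ <;>
        simp only [ne_eq, Prod.mk.injEq] <;> omega
  · by_cases hnext : ∃ s, IsNext α m i s ∧ s ≤ i'
    · obtain ⟨s, hs, hsi⟩ := hnext
      have he := yIdx_of_isNext hm hs
      refine ⟨m, s, hs.2.1, hs.1.le, hsi, he.le, by omega, ?_, ?_⟩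
      · have := hs.1
        simp only [ne_eq, Prod.mk.injEq]
        omega
      · rintro ⟨rfl, rfl⟩
        omega
    · have hk'm : k' < m := by
        by_contra hcon
        obtain ⟨s, hs⟩ := exists_isNext hi (cd_left hb hm (by omega : m ≤ k'))
        exact hnext ⟨s, hs, hs.2.2 _ hi (cd_left hb hm (by omega))⟩
      exfalso
      rcases isNext_or_top (α := α) m i with ⟨s, hs⟩ | htop
      · rw [yIdx_of_isNext hm hs] at hy
        have hsi : i' < s := by
          by_contra hcon
          exact hnext ⟨s, hs, by omega⟩
        have h1 := yIdx_column_le hsi.le hb (cd_left hs.2.1 hpb.1 hk'm.le)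
        have h2 := yIdx_row_le hpb.1 hk'm.le hs.2.1
        omega
      · rw [yIdx_of_top hm htop] at hy
        have h1 := yIdx_lt_cntBB hpb.1 hb
        have h2 := cntBB_mono (α := α) hk'm.le
        omega

/-! ### The sets built by the algorithm -/

variable (α) in
/-- The set `Y_{j+1}`. -/
noncomputable def fiber (j : ℕ) : Finset Box := (cd α).filter fun b => yIdx α b.1 b.2 = j

theorem mem_fiber {j x y : ℕ} : (x, y) ∈ fiber α j ↔ (x, y) ∈ cd α ∧ yIdx α x y = j := by
  simp [fiber]

theorem exists_fiber_column {j k r m e : ℕ} (h : (k, r) ∈ fiber α j) (hm : (m, e) ∈ fiber α j)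
    (hkm : k < m) : ∃ e', (k + 1, e') ∈ fiber α j := by
  induction m, hkm using Nat.le_induction generalizing e with
  | base => exact ⟨e, hm⟩
  | succ m hkm ih =>
    rw [mem_fiber] at h hm
    have hk := (cd_pos h.1).1
    rcases isNext_or_top (α := α) m e with ⟨s, hs⟩ | htop
    · exact ih (mem_fiber.2 ⟨hs.2.1, by rw [← hm.2, yIdx_of_isNext (by omega) hs]⟩)
    · have h1 := yIdx_of_top (by omega) htop
      have h2 := yIdx_lt_cntBB hk h.1
      have h3 := cntBB_mono (α := α) (by omega : k ≤ m)
      omega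

theorem fiber_column_unique {j k e e' : ℕ} (hk : 2 ≤ k) (h : (k, e) ∈ fiber α j)
    (h' : (k, e') ∈ fiber α j) : e = e' := by
  rw [mem_fiber] at h h'
  by_contra hne
  rcases lt_or_gt_of_ne hne with hlt | hlt
  · have := (yIdx_column (by omega) hlt h.1 h'.1).2 (Or.inl hk); omega
  · have := (yIdx_column (by omega) hlt h'.1 h.1).2 (Or.inl hk); omega

/-- The selection rule of the algorithm: unused boxes have index at least $j$, and those below row
$r$ have index at most $j$ by `yIdx_diag`. The lowermost candidate is then the only one. -/
theorem mem_fiber_succ_iff {j k r e : ℕ} (h : (k, r) ∈ fiber α j) :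
    (k + 1, e) ∈ fiber α j ↔ (k + 1, e) ∈ cd α ∧ j ≤ yIdx α (k + 1) e ∧ e < r := by
  rw [mem_fiber] at h ⊢
  have hk := (cd_pos h.1).1
  constructor
  · rintro ⟨h1, h2⟩
    refine ⟨h1, h2.ge, ?_⟩
    by_contra! hcon
    have h3 := yIdx_column_le hcon h.1 (cd_left h1 hk (by omega))
    have h4 := yIdx_succ hk h1
    omega
  · rintro ⟨h1, h2, h3⟩
    have := yIdx_diag h.1 h3
    exact ⟨h1, by omega⟩

theorem chain_eq {j : ℕ} {A : Finset Box}
    (hA : ∀ b, b ∈ A ↔ b ∈ cd α ∧ j ≤ yIdx α b.1 b.2) (f : ℕ) : ∀ {k r : ℕ},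
    (k, r) ∈ fiber α j →
    chain A f (k, r) = (fiber α j).filter fun b => k < b.1 ∧ b.1 ≤ k + f := by
  induction f with
  | zero =>
    intro k r h
    symm
    rw [chain, Finset.filter_eq_empty_iff]
    intro b _
    omega
  | succ f ih =>
    intro k r h
    have hS : ∀ e, e ∈ (A.filter fun b => b.1 = k + 1 ∧ b.2 < r).image Prod.snd ↔
        (k + 1, e) ∈ fiber α j := by
      intro e
      rw [mem_fiber_succ_iff h]
      simp only [Finset.mem_image, Finset.mem_filter, hA, Prod.exists]
      constructor
      · rintro ⟨x, y, ⟨⟨h1, h2⟩, rfl, h3⟩, rfl⟩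
        exact ⟨h1, h2, h3⟩
      · rintro ⟨h1, h2, h3⟩
        exact ⟨k + 1, e, ⟨⟨h1, h2⟩, rfl, h3⟩, rfl⟩
    rw [chain]
    simp only
    split_ifs with hne
    · have hs := (hS _).1 (Finset.min'_mem _ hne)
      rw [ih hs]
      ext ⟨x, y⟩
      simp only [Finset.mem_insert, Finset.mem_filter, Prod.mk.injEq]
      constructor
      · rintro (⟨rfl, rfl⟩ | ⟨h1, h2⟩)
        · exact ⟨hs, by omega⟩
        · exact ⟨h1, by omega⟩
      · rintro ⟨h1, h2⟩
        by_cases hx : x = k + 1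
        · subst hx
          have hk := (cd_pos (mem_fiber.1 h).1).1
          exact Or.inl ⟨rfl, fiber_column_unique (by omega) h1 hs⟩
        · exact Or.inr ⟨h1, by omega⟩
    · symm
      rw [Finset.filter_eq_empty_iff]
      rintro ⟨x, y⟩ h1 h2
      obtain ⟨e, he⟩ := exists_fiber_column h h1 h2.1
      exact hne ⟨e, (hS e).2 he⟩

theorem mem_listBB {b : Box} : b ∈ listBB α ↔ b ∈ BB α := by
  simp only [listBB, List.mem_map, Finset.mem_sort, Finset.mem_image]
  exact ⟨fun ⟨_, ⟨c, hc, h1⟩, h2⟩ => by rw [← h2, ← h1]; exact hc,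
    fun h => ⟨toLex b, ⟨b, h, rfl⟩, rfl⟩⟩

theorem listBB_sorted : (listBB α).Pairwise fun a b => toLex a < toLex b := by
  rw [listBB, List.pairwise_map]
  exact (Finset.sortedLT_sort _).pairwise

theorem length_listBB : (listBB α).length = (BB α).card := by
  rw [listBB, List.length_map, Finset.length_sort, Finset.card_image_of_injective _ toLex.injective]

/-- The `j`-th element of the list `BB(α)` lies in the `j`-th set. -/
theorem yIdx_of_listBB {pre l : List Box} {κ : Box} (h : listBB α = pre ++ κ :: l) :
    yIdx α κ.1 κ.2 = pre.length := by
  have hsort := listBB_sorted (α := α)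
  rw [h, List.pairwise_append, List.pairwise_cons] at hsort
  obtain ⟨hpre, ⟨hl, -⟩, hlt⟩ := hsort
  have hκ : κ ∈ BB α := mem_listBB.1 (by simp [h])
  have hnd : pre.Nodup := hpre.imp fun {a b} hab he => by rw [he] at hab; exact lt_irrefl _ hab
  -- The position of $\kappa$ counts its lexicographic predecessors. Beyond column 1 a column has at
  -- most one box of $\mathsf{BB}(\alpha)$, so these are the ones in earlier columns.
  have hcard : ((BB α).filter fun b => toLex b < toLex κ).card = pre.length := by
    rw [← List.toFinset_card_of_nodup hnd]
    congr 1
    ext b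
    rw [Finset.mem_filter, ← mem_listBB, h, List.mem_toFinset, List.mem_append, List.mem_cons]
    constructor
    · rintro ⟨h1 | rfl | h1, h2⟩
      · exact h1
      · exact absurd h2 (lt_irrefl _)
      · exact absurd h2 (hl b h1).asymm
    · exact fun h1 => ⟨Or.inl h1, hlt b h1 κ List.mem_cons_self⟩
  rw [← hcard]
  obtain ⟨x, y⟩ := κ
  have hcd := BB_subset hκ
  have hx := (cd_pos hcd).1
  simp only [Prod.Lex.toLex_lt_toLex]
  rcases hx.eq_or_lt with rfl | hx
  · rw [yIdx_one]
    congr 1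
    refine Finset.filter_congr fun b hb => ?_
    have := (cd_pos (x := b.1) (y := b.2) (BB_subset hb)).1
    omega
  · obtain ⟨k, rfl⟩ : ∃ k, x = k + 1 := ⟨x - 1, by omega⟩
    rw [yIdx_of_top (by omega) ((mem_BB_succ (by omega)).1 hκ).2, cntBB]
    congr 1
    refine Finset.filter_congr ?_
    rintro ⟨x', y'⟩ hb
    have : ¬ (x' = k + 1 ∧ y' < y) := by
      rintro ⟨rfl, h2⟩
      exact ((mem_BB_succ (by omega)).1 hb).2 y h2 (cd_left hcd (by omega) (by omega))
    simp only at *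
    omega

theorem yIdx_one_le_iff {d r : ℕ} (hd : (1, d) ∈ BB α) (hr : (1, r) ∈ cd α) :
    yIdx α 1 r ≤ yIdx α 1 d ↔ r ≤ d := by
  constructor
  · intro h
    by_contra! hlt
    refine absurd h (not_le.2 ?_)
    rw [yIdx_one, yIdx_one]
    refine Finset.card_lt_card ((Finset.ssubset_iff_of_subset fun κ hκ => ?_).2 ⟨(1, d), ?_, ?_⟩)
    · simp only [Finset.mem_filter] at hκ ⊢
      exact ⟨hκ.1, hκ.2.1, hκ.2.2.trans hlt⟩
    · rw [Finset.mem_filter]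
      exact ⟨hd, rfl, hlt⟩
    · simp
  · exact fun h => yIdx_column_le h hr (BB_subset hd)

theorem fiber_one {pre l : List Box} {p d r : ℕ} (h : listBB α = pre ++ (1, d) :: l)
    (hp : pre = [] ∧ p = 0 ∨ ∃ pre' κ, pre = pre' ++ [κ] ∧ p = κ.2) (hr : (1, r) ∈ cd α) :
    yIdx α 1 r = pre.length ↔ p < r ∧ r ≤ d := by
  have hd := yIdx_of_listBB h
  have hle := yIdx_one_le_iff (d := d) (mem_listBB.1 (by simp [h])) hr
  simp only at hd
  rcases hp with ⟨rfl, rfl⟩ | ⟨pre', ⟨x, p⟩, rfl, rfl⟩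
  · have := (cd_pos hr).2.1
    simp only [List.length_nil] at *
    omega
  · have h' : listBB α = pre' ++ (x, p) :: ((1, d) :: l) := by simp [h]
    have hκ : (x, p) ∈ BB α := mem_listBB.1 (by simp [h])
    have hx : x = 1 := by
      have hsort := listBB_sorted (α := α)
      rw [h', List.pairwise_append, List.pairwise_cons] at hsort
      have h1 := hsort.2.1.1 (1, d) List.mem_cons_self
      rw [Prod.Lex.toLex_lt_toLex] at h1
      have := (cd_pos (BB_subset hκ)).1
      simp only at h1
      omega
    subst hx
    have hd' := yIdx_of_listBB h'
    have hle' := yIdx_one_le_iff hκ hr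
    simp only [List.length_append, List.length_cons, List.length_nil] at *
    omega

/-- Loop invariant: after the prefix `pre`, the unused boxes are those of index at least its length,
and `p` is the row of its last element, or $0$ at the start. -/
theorem buildY_eq (l : List Box) : ∀ (pre : List Box) (A : Finset Box) (p : ℕ),
    listBB α = pre ++ l → (∀ b, b ∈ A ↔ b ∈ cd α ∧ pre.length ≤ yIdx α b.1 b.2) →
    (pre = [] ∧ p = 0 ∨ ∃ pre' κ, pre = pre' ++ [κ] ∧ p = κ.2) →
    buildY n A p l = (List.range' pre.length l.length).map (fiber α) := by
  induction l with
  | nil => intros; simp [buildY]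
  | cons κ l ih =>
    intro pre A p h hA hp
    have hY : (if κ.1 = 1 then (Finset.Ioc p κ.2).image (fun y => (1, y)) ∪ chain A n (1, p + 1)
        else {κ} ∪ chain A n κ) = fiber α pre.length := by
      have hκ : κ ∈ BB α := mem_listBB.1 (by simp [h])
      have hidx := yIdx_of_listBB h
      obtain ⟨x, d⟩ := κ
      have hcd := BB_subset hκ
      simp only at *
      split_ifs with hx
      · subst hx
        have hpd := (fiber_one h hp hcd).1 hidx
        have hd := cd_pos hcd
        have hp1 : (1, p + 1) ∈ cd α := cd_one.2 (by omega)
        rw [chain_eq hA n (mem_fiber.2 ⟨hp1, (fiber_one h hp hp1).2 (by omega)⟩)]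
        ext ⟨x, y⟩
        simp only [Finset.mem_union, Finset.mem_image, Finset.mem_Ioc, Finset.mem_filter,
          Prod.mk.injEq]
        constructor
        · rintro (⟨y', hy', rfl, rfl⟩ | h1)
          · have hy1 : (1, y') ∈ cd α := cd_one.2 (by omega)
            exact mem_fiber.2 ⟨hy1, (fiber_one h hp hy1).2 hy'⟩
          · exact h1.1
        · intro h1
          have h2 := mem_fiber.1 h1
          have h3 := (cd_pos h2.1).1
          have h4 := cd_le h2.1
          by_cases hx : x = 1
          · subst hx
            exact Or.inl ⟨y, (fiber_one h hp h2.1).1 h2.2, rfl, rfl⟩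
          · exact Or.inr ⟨h1, by omega⟩
      · have hx1 := (cd_pos hcd).1
        have hmem : (x, d) ∈ fiber α pre.length := mem_fiber.2 ⟨hcd, hidx⟩
        rw [chain_eq hA n hmem]
        obtain ⟨k, rfl⟩ : ∃ k, x = k + 1 := ⟨x - 1, by omega⟩
        ext ⟨x', y⟩
        simp only [Finset.mem_union, Finset.mem_singleton, Finset.mem_filter, Prod.mk.injEq]
        constructor
        · rintro (⟨rfl, rfl⟩ | h1)
          · exact hmem
          · exact h1.1
        · intro h1
          have h2 := mem_fiber.1 h1
          have h3 := (cd_pos h2.1).1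
          have h4 := cd_le h2.1
          rcases lt_trichotomy x' (k + 1) with h5 | rfl | h5
          · have h6 := yIdx_of_top (by omega) ((mem_BB_succ (by omega)).1 hκ).2
            have h7 := yIdx_lt_cntBB h3 h2.1
            have h8 := cntBB_mono (α := α) (by omega : x' ≤ k)
            omega
          · exact Or.inl ⟨rfl, fiber_column_unique (by omega) h1 hmem⟩
          · exact Or.inr ⟨h1, by omega⟩
    rw [buildY]
    rw [hY, ih (pre ++ [κ]) _ κ.2 (by simp [h]) _ (Or.inr ⟨pre, κ, rfl, rfl⟩)]
    · simp [List.range'_succ]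
    · rintro ⟨x, y⟩
      rw [Finset.mem_sdiff, hA, mem_fiber]
      simp only [List.length_append, List.length_cons, List.length_nil]
      constructor
      · rintro ⟨⟨h1, h2⟩, h3⟩
        have : ¬ yIdx α x y = pre.length := fun h4 => h3 ⟨h1, h4⟩
        exact ⟨h1, by omega⟩
      · rintro ⟨h1, h2⟩
        exact ⟨⟨h1, by omega⟩, fun h3 => by omega⟩

theorem listY_eq : listY α = (List.range (BB α).card).map (fiber α) := by
  rw [listY, buildY_eq (α := α) (listBB α) [] (cd α) 0 (by simp) (by simp) (Or.inl ⟨rfl, rfl⟩),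
    List.range_eq_range', length_listBB]
  rfl

theorem yIdx_lt {x y : ℕ} (h : (x, y) ∈ cd α) : yIdx α x y < (BB α).card :=
  (yIdx_lt_cntBB (cd_pos h).1 h).trans_le (cntBB_le x)

theorem indexY_eq {x y : ℕ} (h : (x, y) ∈ cd α) : indexY α (x, y) = yIdx α x y := by
  have hlen : yIdx α x y < (listY α).length := by
    rw [listY_eq, List.length_map, List.length_range]
    exact yIdx_lt h
  rw [indexY, List.findIdx_eq hlen]
  simp only [listY_eq, List.getElem_map, List.getElem_range, mem_fiber, decide_eq_true_eq,
    decide_eq_false_iff_not, and_true]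
  exact ⟨h, fun j hj h' => by omega⟩

theorem canonicalDiagram_eq :
    canonicalDiagram α = (cd α).image fun b => (b.2, yIdx α b.1 b.2 + 1) := by
  ext ⟨i, j⟩
  rw [canonicalDiagram, Finset.mem_filter, Finset.mem_product]
  simp only [Finset.mem_Icc,
    Finset.mem_image, Prod.exists, Prod.mk.injEq, Finset.Nonempty, Finset.mem_inter]
  constructor
  · rintro ⟨⟨hi, hj⟩, x, y, hx, hy⟩
    simp only [rowX, Finset.mem_filter] at hx
    rw [listY_eq] at hy hj
    rw [List.length_map, List.length_range] at hj
    rw [List.getD_eq_getElem _ _ (by simp; omega)] at hy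
    simp only [List.getElem_map, List.getElem_range, mem_fiber] at hy
    exact ⟨x, y, hx.1, hx.2, by omega⟩
  · rintro ⟨x, y, h, rfl, rfl⟩
    have hp := cd_pos h
    have hlt := yIdx_lt h
    rw [listY_eq, List.length_map, List.length_range]
    refine ⟨⟨hp.2, by omega, by omega⟩, x, y, by simp [rowX, h], ?_⟩
    rw [List.getD_eq_getElem _ _ (by simp; omega)]
    simp [mem_fiber, h]

theorem yIdx_row_injective {x x' y : ℕ} (h : (x, y) ∈ cd α) (h' : (x', y) ∈ cd α)
    (he : yIdx α x y = yIdx α x' y) : x = x' := by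
  by_contra hne
  rcases lt_or_gt_of_ne hne with hlt | hlt
  · exact (yIdx_row (cd_pos h).1 hlt h').ne he
  · exact (yIdx_row (cd_pos h').1 hlt h).ne' he

theorem isDiagram_canonicalDiagram : IsDiagram n (canonicalDiagram α) := by
  rw [canonicalDiagram_eq]
  refine ⟨?_, ?_, ?_, ?_⟩
  · rw [Finset.card_image_of_injOn, card_cd]
    rintro ⟨x, y⟩ h ⟨x', y'⟩ h' he
    simp only [Prod.mk.injEq, Nat.add_right_cancel_iff] at he
    obtain ⟨rfl, he⟩ := he
    rw [yIdx_row_injective h h' he]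
  · simp only [Finset.mem_image, Prod.exists, forall_exists_index, and_imp]
    rintro _ x y h rfl
    exact ⟨(cd_pos h).2.1, by simp⟩
  · simp only [Finset.mem_image, Prod.exists, forall_exists_index, and_imp]
    rintro _ x y h rfl z hz1 hz2
    have := cd_pos h
    exact ⟨_, _, ⟨1, z, cd_one.2 ⟨hz1, by simp only at hz2; omega⟩, rfl⟩, rfl⟩
  · simp only [Finset.mem_image, Prod.exists, forall_exists_index, and_imp]
    rintro _ x y h rfl z hz1 hz2
    have hlt := yIdx_lt h
    simp only at hz2
    -- Row $z$ is nonempty because it contains the image of the $z$-th element of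
    -- $\mathsf{BB}(\alpha)$.
    have hz : z - 1 < (listBB α).length := by rw [length_listBB]; omega
    have hsplit : listBB α = (listBB α).take (z - 1) ++ (listBB α)[z - 1] ::
        (listBB α).drop (z - 1 + 1) := by
      rw [List.getElem_cons_drop, List.take_append_drop]
    have hidx := yIdx_of_listBB hsplit
    rw [List.length_take, min_eq_left hz.le] at hidx
    refine ⟨_, _, ⟨(listBB α)[z - 1].1, (listBB α)[z - 1].2,
      BB_subset (mem_listBB.1 (List.getElem_mem hz)), rfl⟩, ?_⟩
    simp only [hidx]
    omega

theorem isFree_canonicalDiagram : IsFree (canonicalDiagram α) := by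
  rintro a b ⟨ha, hb, h1, h2, h3⟩
  rw [canonicalDiagram_eq] at ha hb h3
  simp only [Finset.mem_image, Prod.exists] at ha hb
  obtain ⟨k, i, ha, rfl⟩ := ha
  obtain ⟨k', i', hb, rfl⟩ := hb
  simp only at h1 h2 h3
  obtain ⟨x, y, hc, h4, h5, h6, h7, h8, h9⟩ := exists_between ha hb h1 (by omega)
  have h10 := h3 (y, yIdx α x y + 1) (Finset.mem_image.2 ⟨(x, y), hc, rfl⟩) h4 h5
    (by simp only; omega) (by simp only; omega)
  simp only [Prod.mk.injEq, Nat.add_right_cancel_iff] at h10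
  rcases h10 with ⟨rfl, he⟩ | ⟨rfl, he⟩
  · exact h8 (by rw [yIdx_row_injective hc ha he])
  · exact h9 (by rw [yIdx_row_injective hc hb he])

end Algorithm

/-! ### The canonical class as the standard tableaux of the diagram -/

section Canonical

variable {n : ℕ} {α : Composition n}

theorem sourceSYCT_lt_iff {a b : cd α} : sourceSYCT α a < sourceSYCT α b ↔
    a.1.2 < b.1.2 ∨ a.1.2 = b.1.2 ∧ a.1.1 < b.1.1 := rowTableau_lt_iff (card_cd α)

/-- The tableaux of the canonical class are the linear extensions of the order generated by the
rows, the columns, and the pairs of boxes `(k + 1, j)`, `(k, i)` with `j < i`. -/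
theorem mem_canonicalSYCT_iff {τ : Filling n (cd α)} : τ ∈ canonicalSYCT α ↔
    (∀ a b : cd α, a.1.2 = b.1.2 → a.1.1 < b.1.1 → τ a < τ b) ∧
    (∀ a b : cd α, a.1.1 = b.1.1 → a.1.2 < b.1.2 → τ a < τ b) ∧
    (∀ a b : cd α, b.1.1 = a.1.1 + 1 → b.1.2 < a.1.2 → τ b < τ a) := by
  constructor
  · rintro ⟨⟨h1, -, h3⟩, h4⟩
    have hcol : ∀ a b : cd α, a.1.1 = b.1.1 → a.1.2 < b.1.2 → τ a < τ b := fun a b h5 h6 =>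
      (h4 a b h5).2 (sourceSYCT_lt_iff.2 (Or.inl h6))
    refine ⟨h1, hcol, fun a b h5 h6 => ?_⟩
    by_contra hcon
    -- The triple rule would supply a box above $b$ in its column with a smaller entry, against the
    -- column order of the source; hence its premise never holds.
    obtain ⟨c, hc, hlt⟩ := h3 a b h5 h6
      (τ.lt_of_le (not_lt.1 hcon) (by rintro rfl; omega))
    refine absurd hlt (hcol b c ?_ ?_).asymm <;> rw [hc]
    · exact h5
    · exact h6
  · rintro ⟨h1, h2, h3⟩
    refine ⟨⟨h1, fun a b h4 h5 => h2 a b (h4.trans h5.symm), fun a b h4 h5 h6 =>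
      absurd h6 (h3 a b h4 h5).asymm⟩, fun a b h4 => ?_⟩
    rw [sourceSYCT_lt_iff]
    constructor
    · intro h5
      by_contra hcon
      by_cases hab : a = b
      · rw [hab] at h5; exact absurd h5 (lt_irrefl _)
      · have : a.1.2 ≠ b.1.2 := fun he => hab (box_ext h4 he)
        exact absurd h5 (h2 b a h4.symm (by omega)).asymm
    · intro h5
      exact h2 a b h4 (by omega)

theorem mem_canonicalDiagram {x y : ℕ} (h : (x, y) ∈ cd α) :
    (y, yIdx α x y + 1) ∈ canonicalDiagram α := by
  rw [canonicalDiagram_eq]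
  exact Finset.mem_image.2 ⟨(x, y), h, rfl⟩

variable (α) in
/-- The bijection from the composition diagram to the diagram produced by the algorithm. -/
noncomputable def boxEquiv : cd α ≃ canonicalDiagram α :=
  Equiv.ofBijective (fun b => ⟨(b.1.2, yIdx α b.1.1 b.1.2 + 1), mem_canonicalDiagram b.2⟩) <| by
    constructor
    · rintro ⟨⟨x, y⟩, h⟩ ⟨⟨x', y'⟩, h'⟩ he
      simp only [Subtype.mk.injEq, Prod.mk.injEq, Nat.add_right_cancel_iff] at he
      obtain ⟨rfl, he⟩ := he
      obtain rfl := yIdx_row_injective h h' he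
      rfl
    · rintro ⟨c, hc⟩
      have hc' := hc
      rw [canonicalDiagram_eq, Finset.mem_image] at hc'
      obtain ⟨b, hb, rfl⟩ := hc'
      exact ⟨⟨b, hb⟩, rfl⟩

theorem boxEquiv_fst (b : cd α) : (boxEquiv α b).1.1 = b.1.2 := rfl

theorem boxEquiv_snd (b : cd α) : (boxEquiv α b).1.2 = yIdx α b.1.1 b.1.2 + 1 := rfl

/-- The filling of the diagram produced by the algorithm that corresponds to a filling of the
composition diagram. -/
noncomputable def push (F : Filling n (cd α)) : Filling n (canonicalDiagram α) :=
  (boxEquiv α).symm.trans F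

@[simp] theorem push_boxEquiv (F : Filling n (cd α)) (b : cd α) : push F (boxEquiv α b) = F b := by
  simp [push]

theorem readAlong_push (R F : Filling n (cd α)) :
    readAlong (push R) (push F) = readAlong R F := by
  ext p
  simp [readAlong, push]

theorem exists_push (G : Filling n (canonicalDiagram α)) : ∃ F, push F = G :=
  ⟨(boxEquiv α).trans G, by ext; simp [push]⟩

theorem push_injective : Function.Injective (push (n := n) (α := α)) := by
  intro F G h
  ext b
  rw [← push_boxEquiv, ← push_boxEquiv, h]

theorem push_eq_of_lt {F : Filling n (cd α)} {G : Filling n (canonicalDiagram α)}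
    (h : ∀ a b, F a < F b → G (boxEquiv α a) < G (boxEquiv α b)) : push F = G := by
  apply Filling.ext_of_lt
  intro a b
  obtain ⟨a, rfl⟩ := (boxEquiv α).surjective a
  obtain ⟨b, rfl⟩ := (boxEquiv α).surjective b
  rw [push_boxEquiv, push_boxEquiv]
  exact h a b

/-- Passing to successors moves left and up within one set and increases the entry at each step;
starting from $a$ one meets $b$, or reaches its column below it and uses the column order. -/
theorem lt_of_yIdx_eq {τ : Filling n (cd α)} (hτ : τ ∈ canonicalSYCT α) {b : cd α} (m : ℕ) :
    ∀ a : cd α, a.1.1 = m → a.1.2 < b.1.2 → yIdx α a.1.1 a.1.2 = yIdx α b.1.1 b.1.2 →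
      τ a < τ b := by
  rw [mem_canonicalSYCT_iff] at hτ
  obtain ⟨⟨k', i'⟩, hb⟩ := b
  have hpb := cd_pos hb
  induction m with
  | zero =>
    rintro ⟨⟨k, i⟩, ha⟩ hk
    have := cd_pos ha
    simp only at hk
    omega
  | succ m ih =>
    rintro ⟨⟨k, i⟩, ha⟩ rfl hi hy
    simp only at hi hy
    have hle : k' ≤ m + 1 := by
      by_contra! hcon
      have h1 := cd_left hb (cd_pos ha).1 hcon.le
      have h2 := yIdx_column_le hi.le ha h1
      have h3 := yIdx_row (cd_pos ha).1 hcon hb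
      omega
    rcases hle.eq_or_lt with rfl | hlt
    · exact hτ.2.1 _ _ rfl hi
    rcases isNext_or_top (α := α) m i with ⟨s, hs⟩ | htop
    · rw [yIdx_of_isNext (by omega) hs] at hy
      have hs1 : τ ⟨(m + 1, i), ha⟩ < τ ⟨(m, s), hs.2.1⟩ := hτ.2.2 _ _ rfl hs.1
      by_cases he : (m, s) = (k', i')
      · have he' : (⟨(m, s), hs.2.1⟩ : cd α) = ⟨(k', i'), hb⟩ := Subtype.ext he
        rwa [he'] at hs1
      · refine hs1.trans (ih ⟨(m, s), hs.2.1⟩ rfl ?_ hy)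
        by_contra! hcon
        simp only at hcon
        have h1 := cd_left hs.2.1 hpb.1 (by omega : k' ≤ m)
        have h2 := yIdx_column_le hcon hb h1
        by_cases hk : k' = m
        · subst hk
          have h3 := hs.2.2 i' hi hb
          exact he (by rw [le_antisymm h3 hcon])
        · have h3 := yIdx_row hpb.1 (by omega : k' < m) hs.2.1
          omega
    · rw [yIdx_of_top (by omega) htop] at hy
      have h1 := yIdx_lt_cntBB hpb.1 hb
      have h2 := cntBB_mono (α := α) (by omega : k' ≤ m)
      omega

/-- The canonical class consists of the standard tableaux on the diagram produced by the
algorithm. -/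
theorem push_mem_stdTableaux_iff {τ : Filling n (cd α)} :
    push τ ∈ stdTableaux n (canonicalDiagram α) ↔ τ ∈ canonicalSYCT α := by
  constructor
  · intro h
    have h' : ∀ a b : cd α, a ≠ b → a.1.2 ≤ b.1.2 →
        yIdx α a.1.1 a.1.2 ≤ yIdx α b.1.1 b.1.2 → τ a < τ b := by
      intro a b hne h1 h2
      refine τ.lt_of_le ?_ hne
      have := h (boxEquiv α a) (boxEquiv α b) h1 (Nat.succ_le_succ h2)
      rwa [push_boxEquiv, push_boxEquiv] at this
    rw [mem_canonicalSYCT_iff]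
    refine ⟨?_, ?_, ?_⟩
    · rintro ⟨⟨x, y⟩, ha⟩ ⟨⟨x', y'⟩, hb⟩ rfl h2
      exact h' _ _ (fun he => h2.ne (congrArg (fun b => b.1.1) he)) le_rfl
        (yIdx_row (cd_pos ha).1 h2 hb).le
    · rintro ⟨⟨x, y⟩, ha⟩ ⟨⟨x', y'⟩, hb⟩ rfl h2
      exact h' _ _ (fun he => h2.ne (congrArg (fun b => b.1.2) he)) h2.le
        (yIdx_column_le h2.le ha hb)
    · rintro ⟨⟨x, y⟩, ha⟩ ⟨⟨x', y'⟩, hb⟩ rfl h2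
      exact h' _ _ (fun he => h2.ne (congrArg (fun b => b.1.2) he)) h2.le (yIdx_diag ha h2)
  · intro h
    have hrow := (mem_canonicalSYCT_iff.1 h).1
    have key : ∀ k : ℕ, ∀ A B : canonicalDiagram α, B.1.1 - A.1.1 + (B.1.2 - A.1.2) = k →
        A.1.1 ≤ B.1.1 → A.1.2 ≤ B.1.2 → push τ A ≤ push τ B := by
      intro k
      induction k using Nat.strong_induction_on with
      | _ k ih =>
      intro A B hk h1 h2
      by_cases hAB : A = B
      · rw [hAB]
      have hne : ¬ (A.1.1 = B.1.1 ∧ A.1.2 = B.1.2) := fun h => hAB (box_ext h.1 h.2)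
      -- Freeness lets a strictly upper-right comparison be subdivided until the boxes share a
      -- column of $\mathscr C$ (a row of $\mathrm{cd}(\alpha)$) or a row of $\mathscr C$ (a set
      -- $Y_j$).
      by_cases hs : A.1.1 < B.1.1 ∧ A.1.2 < B.1.2
      · have hex : ∃ C : canonicalDiagram α, A.1.1 ≤ C.1.1 ∧ C.1.1 ≤ B.1.1 ∧ A.1.2 ≤ C.1.2 ∧
            C.1.2 ≤ B.1.2 ∧ C ≠ A ∧ C ≠ B := by
          by_contra! hcon
          refine isFree_canonicalDiagram A.1 B.1 ⟨A.2, B.2, hs.1, hs.2, ?_⟩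
          intro c hc c1 c2 c3 c4
          by_cases hcA : (⟨c, hc⟩ : canonicalDiagram α) = A
          · exact Or.inl (congrArg Subtype.val hcA)
          · exact Or.inr (congrArg Subtype.val (hcon ⟨c, hc⟩ c1 c2 c3 c4 hcA))
        obtain ⟨C, c1, c2, c3, c4, c5, c6⟩ := hex
        have d1 : ¬ (C.1.1 = A.1.1 ∧ C.1.2 = A.1.2) := fun h => c5 (box_ext h.1 h.2)
        have d2 : ¬ (C.1.1 = B.1.1 ∧ C.1.2 = B.1.2) := fun h => c6 (box_ext h.1 h.2)
        exact (ih _ (by omega) A C rfl c1 c3).trans (ih _ (by omega) C B rfl c2 c4)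
      · obtain ⟨a, rfl⟩ := (boxEquiv α).surjective A
        obtain ⟨b, rfl⟩ := (boxEquiv α).surjective B
        rw [push_boxEquiv, push_boxEquiv]
        simp only [boxEquiv_fst, boxEquiv_snd] at h1 h2 hs hne
        by_cases hy : yIdx α a.1.1 a.1.2 = yIdx α b.1.1 b.1.2
        · exact (lt_of_yIdx_eq h _ a rfl (by omega) hy).le
        · obtain ⟨⟨x, y⟩, ha⟩ := a
          obtain ⟨⟨x', y'⟩, hb⟩ := b
          simp only at *
          obtain rfl : y = y' := by omega
          have hxx : x < x' := by
            by_contra! hcon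
            have := yIdx_row_le (cd_pos hb).1 hcon ha
            omega
          exact (hrow ⟨(x, y), ha⟩ ⟨(x', y), hb⟩ rfl hxx).le
    intro A B
    exact key _ A B rfl

theorem push_sourceSYCT (h : (canonicalDiagram α).card = n) :
    push (sourceSYCT α) = columnTableau h := by
  apply push_eq_of_lt
  rintro ⟨⟨x, y⟩, ha⟩ ⟨⟨x', y'⟩, hb⟩ hlt
  rw [sourceSYCT_lt_iff] at hlt
  rw [columnTableau_lt_iff]
  simp only [boxEquiv_fst, boxEquiv_snd] at *
  rcases hlt with h1 | ⟨rfl, h1⟩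
  · exact Or.inl h1
  · exact Or.inr ⟨rfl, Nat.succ_lt_succ (yIdx_row (cd_pos ha).1 h1 hb)⟩

theorem push_keyRLBT (h : (canonicalDiagram α).card = n) :
    push (orderFilling (card_cd α) keyRLBT keyRLBT_injective) =
      orderFilling h keyTBLR keyTBLR_injective := by
  apply push_eq_of_lt
  rintro ⟨⟨x, y⟩, ha⟩ ⟨⟨x', y'⟩, hb⟩ hlt
  rw [orderFilling_keyRLBT_lt_iff] at hlt
  rw [orderFilling_keyTBLR_lt_iff]
  simp only [boxEquiv_fst, boxEquiv_snd] at *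
  rcases hlt with h1 | ⟨rfl, h1⟩
  · exact Or.inl h1
  · exact Or.inr ⟨rfl, Nat.succ_lt_succ (yIdx_row (cd_pos hb).1 h1 ha)⟩

theorem readRLBT_eq (h : (canonicalDiagram α).card = n) (τ : Filling n (cd α)) :
    readRLBT τ = readAlong (orderFilling h keyTBLR keyTBLR_injective) (push τ) := by
  rw [← push_keyRLBT h, readAlong_push]
  rfl

theorem canonicalWords_eq (h : (canonicalDiagram α).card = n) :
    canonicalWords α = sigmaL (fillingPoset
      (orderFilling h keyTBLR keyTBLR_injective : Filling n (canonicalDiagram α))) := by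
  rw [sigmaL_fillingPoset, canonicalWords]
  ext σ
  constructor
  · rintro ⟨τ, hτ, rfl⟩
    exact ⟨push τ, push_mem_stdTableaux_iff.2 hτ, (readRLBT_eq h τ).symm⟩
  · rintro ⟨G, hG, rfl⟩
    obtain ⟨τ, rfl⟩ := exists_push G
    exact ⟨τ, push_mem_stdTableaux_iff.1 hG, readRLBT_eq h τ⟩

/-- Inside one set $Y_j$, increasing entries of the row tableau means increasing columns of
$\mathscr C$. -/
theorem push_rowOrder (h : (canonicalDiagram α).card = n) {τ : Filling n (cd α)}
    (hτ : push τ = rowTableau h) :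
    push (rowOrder α τ) = orderFilling h keyLRTB keyLRTB_injective := by
  apply push_eq_of_lt
  intro a b hlt
  have hτlt := rowTableau_lt_iff h (a := boxEquiv α a) (b := boxEquiv α b)
  rw [← hτ, push_boxEquiv, push_boxEquiv] at hτlt
  replace hlt := (orderFilling_lt_iff (card_cd α) _ _).1 hlt
  rw [Prod.Lex.toLex_lt_toLex, Nat.cast_lt, ← Fin.lt_def, hτlt,
    indexY_eq (x := a.1.1) (y := a.1.2) a.2, indexY_eq (x := b.1.1) (y := b.1.2) b.2] at hlt
  rw [orderFilling_keyLRTB_lt_iff]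
  simp only [boxEquiv_fst, boxEquiv_snd] at *
  omega

/-! ### The sink -/

/-- An incomparable pair of consecutive entries in increasing rows is a descent that is not
attacking. -/
theorem exists_descent {τ : Filling n (cd α)} {i : Fin (n - 1)}
    (h1 : (τ.symm (lo i)).1.2 < (τ.symm (hi i)).1.2)
    (h2 : yIdx α (τ.symm (hi i)).1.1 (τ.symm (hi i)).1.2 <
      yIdx α (τ.symm (lo i)).1.1 (τ.symm (lo i)).1.2) :
    IsDescent τ i ∧ ¬ IsAttacking τ i := by
  change (τ.symm (hi i)).1.1 ≤ (τ.symm (lo i)).1.1 ∧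
    ¬ ((τ.symm (lo i)).1.1 = (τ.symm (hi i)).1.1 ∨
      ((τ.symm (lo i)).1.1 = (τ.symm (hi i)).1.1 + 1 ∧
        (τ.symm (lo i)).1.2 < (τ.symm (hi i)).1.2))
  generalize τ.symm (lo i) = a at *
  generalize τ.symm (hi i) = b at *
  obtain ⟨⟨x, y⟩, ha⟩ := a
  obtain ⟨⟨x', y'⟩, hb⟩ := b
  simp only at *
  have hlt : x' < x := by
    by_contra! hcon
    have hc := cd_left hb (cd_pos ha).1 hcon
    have e1 := yIdx_column_le h1.le ha hc
    have e2 := yIdx_row_le (cd_pos ha).1 hcon hb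
    omega
  refine ⟨hlt.le, ?_⟩
  rintro (rfl | ⟨rfl, -⟩)
  · omega
  · exact absurd h2 (not_lt.2 (yIdx_diag hb h1))

/-- For a nonattacking descent, $i+1$ lies to the left of and above $i$. The successor of the box of
$i$ has the same index and would carry an entry strictly between; without a successor, the index of
$i$ would exceed that of $i+1$. -/
theorem isSink_of_push_eq (h : (canonicalDiagram α).card = n) {τ : Filling n (cd α)}
    (hτ : push τ = rowTableau h) : IsSink α τ := by
  have hmem : τ ∈ canonicalSYCT α := by
    rw [← push_mem_stdTableaux_iff, hτ]
    exact rowTableau_mem h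
  refine ⟨hmem, fun i hdes => ?_⟩
  obtain ⟨hrow, hcol, -⟩ := mem_canonicalSYCT_iff.1 hmem
  by_contra hatt
  have hτlt : ∀ a b : cd α, τ a < τ b ↔ yIdx α a.1.1 a.1.2 < yIdx α b.1.1 b.1.2 ∨
      yIdx α a.1.1 a.1.2 = yIdx α b.1.1 b.1.2 ∧ a.1.2 < b.1.2 := by
    intro a b
    rw [← push_boxEquiv τ a, ← push_boxEquiv τ b, hτ, rowTableau_lt_iff]
    simp only [boxEquiv_fst, boxEquiv_snd]
    omega
  change (τ.symm (hi i)).1.1 ≤ (τ.symm (lo i)).1.1 at hdes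
  change ¬ ((τ.symm (lo i)).1.1 = (τ.symm (hi i)).1.1 ∨
      ((τ.symm (lo i)).1.1 = (τ.symm (hi i)).1.1 + 1 ∧
        (τ.symm (lo i)).1.2 < (τ.symm (hi i)).1.2)) at hatt
  obtain ⟨a, ha⟩ : ∃ a, a = τ.symm (lo i) := ⟨_, rfl⟩
  obtain ⟨b, hb⟩ : ∃ b, b = τ.symm (hi i) := ⟨_, rfl⟩
  have ha' : τ a = lo i := by simp [ha]
  have hb' : τ b = hi i := by simp [hb]
  rw [← ha, ← hb] at hdes hatt
  have hlt : τ a < τ b := by rw [ha', hb']; exact lo_lt_hi i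
  have hbtw : ∀ c, τ a < τ c → τ c < τ b → False := by
    intro c h1 h2
    rcases eq_lo_or_eq_hi (ha' ▸ h1.le) (hb' ▸ h2.le) with h3 | h3
    · rw [h3, ha'] at h1; exact absurd h1 (lt_irrefl _)
    · rw [h3, hb'] at h2; exact absurd h2 (lt_irrefl _)
  clear ha hb ha' hb'
  obtain ⟨⟨x, y⟩, ha⟩ := a
  obtain ⟨⟨x', y'⟩, hb⟩ := b
  simp only at hdes hatt
  have hxx : x' < x := by omega
  have hpb := cd_pos hb
  have hyy : y < y' := by
    by_contra! hcon
    rcases hcon.eq_or_lt with rfl | hcon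
    · exact absurd hlt (hrow ⟨(x', y'), hb⟩ ⟨(x, y'), ha⟩ rfl hxx).asymm
    · have hc := cd_left ha hpb.1 hxx.le
      have e1 : τ ⟨(x', y'), hb⟩ < τ ⟨(x', y), hc⟩ := hcol _ _ rfl hcon
      have e2 : τ ⟨(x', y), hc⟩ < τ ⟨(x, y), ha⟩ := hrow _ _ rfl hxx
      exact absurd hlt (e1.trans e2).asymm
  obtain ⟨m, rfl⟩ : ∃ m, x = m + 1 := ⟨x - 1, by omega⟩
  have hle := (hτlt _ _).1 hlt
  simp only at hle
  rcases isNext_or_top (α := α) m y with ⟨s, hs⟩ | htop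
  · have he := yIdx_of_isNext (by omega) hs
    refine hbtw ⟨(m, s), hs.2.1⟩ ((hτlt _ _).2 (Or.inr ⟨he, hs.1⟩)) ((hτlt _ _).2 ?_)
    simp only
    by_contra hcon
    have e1 := yIdx_column_le (by omega : y' ≤ s) hb
      (cd_left hs.2.1 hpb.1 (by omega : x' ≤ m))
    have e2 := yIdx_row hpb.1 (by omega : x' < m) hs.2.1
    omega
  · have e1 := yIdx_of_top (by omega) htop
    have e2 := yIdx_lt_cntBB hpb.1 hb
    have e3 := cntBB_mono (α := α) (by omega : x' ≤ m)
    omega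

/-- If $\tau$ is not the row tableau, some $i,i+1$ are in the opposite order there. Standardness
makes their boxes incomparable, and `exists_descent` gives a nonattacking descent. -/
theorem push_eq_of_isSink (h : (canonicalDiagram α).card = n) {τ : Filling n (cd α)}
    (hτ : IsSink α τ) : push τ = rowTableau h := by
  by_contra hne
  have hst := push_mem_stdTableaux_iff.2 hτ.1
  obtain ⟨i, hi'⟩ := exists_consecutive (n := n)
    (fun he => hne (readAlong_left_injective (rowTableau h) he))
  have hx : ∀ x, readAlong (rowTableau h) (rowTableau h)
      ((readAlong (rowTableau h) (push τ))⁻¹ x) = rowTableau h (boxEquiv α (τ.symm x)) := by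
    intro x
    simp [readAlong, push, Equiv.Perm.inv_def]
  rw [hx, hx, rowTableau_lt_iff] at hi'
  simp only [boxEquiv_fst, boxEquiv_snd] at hi'
  have hnot : ¬ ((τ.symm (hi i)).1.2 ≤ (τ.symm (lo i)).1.2 ∧
      yIdx α (τ.symm (hi i)).1.1 (τ.symm (hi i)).1.2 ≤
        yIdx α (τ.symm (lo i)).1.1 (τ.symm (lo i)).1.2) := by
    rintro ⟨h1, h2⟩
    have h3 := hst (boxEquiv α (τ.symm (hi i))) (boxEquiv α (τ.symm (lo i))) h1
      (Nat.succ_le_succ h2)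
    rw [push_boxEquiv, push_boxEquiv, Equiv.apply_symm_apply, Equiv.apply_symm_apply] at h3
    exact absurd (lo_lt_hi i) (not_lt.2 h3)
  obtain ⟨h1, h2⟩ := exists_descent (τ := τ) (i := i) (by omega) (by omega)
  exact h2 (hτ.2 i h1)

/-! ### The words of the source tableau -/

theorem card_rowX (i : Fin α.length) : (rowX α (i.1 + 1)).card = α.blocksFun i := by
  have : rowX α (i.1 + 1) = (Finset.Icc 1 (α.blocksFun i)).image fun x => (x, i.1 + 1) := by
    ext ⟨x, y⟩
    simp only [rowX, Finset.mem_filter, mem_cd, Finset.mem_image, Finset.mem_Icc, Prod.mk.injEq]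
    constructor
    · rintro ⟨⟨j, h1, h2⟩, h3⟩
      obtain rfl : i = j := Fin.ext (by omega)
      exact ⟨x, h2, rfl, h3.symm⟩
    · rintro ⟨x', h1, rfl, rfl⟩
      exact ⟨⟨i, rfl, h1⟩, rfl⟩
  rw [this, Finset.card_image_of_injective _ fun x y h => congrArg Prod.fst h, Nat.card_Icc]
  rfl

theorem take_blocks_sum (k : ℕ) :
    (α.blocks.take k).sum = ((cd α).filter fun b => b.2 ≤ k).card := by
  change α.sizeUpTo k = _
  induction k with
  | zero =>
    rw [α.sizeUpTo_zero, eq_comm, Finset.card_eq_zero, Finset.filter_eq_empty_iff]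
    rintro ⟨x, y⟩ h
    have := cd_pos h
    simp only
    omega
  | succ k ih =>
    by_cases hk : k < α.length
    · rw [α.sizeUpTo_succ hk, ih]
      change _ + α.blocksFun ⟨k, hk⟩ = _
      rw [← card_rowX ⟨k, hk⟩, rowX, ← Finset.card_union_of_disjoint]
      · congr 1
        ext b
        simp only [Finset.mem_union, Finset.mem_filter, ← and_or_left, and_congr_right_iff]
        omega
      · rw [Finset.disjoint_filter]
        intro b _
        simp only
        omega
    · rw [α.sizeUpTo_ofLength_le _ (by omega : α.length ≤ k + 1), Finset.filter_true_of_mem, card_cd]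
      rintro ⟨x, y⟩ h
      have := cd_pos h
      simp only
      omega

/-- Reading each row of the source backwards inverts exactly the pairs in one row, that is, those
with no element of $\mathrm{set}(\alpha)$ between their positions. -/
theorem w0_eq_readRLBT : w0 (partialSums n α.blocks)ᶜ = readRLBT (sourceSYCT α) := by
  apply w0_eq
  intro p q hpq
  change readAlong (orderFilling (card_cd α) keyRLBT keyRLBT_injective) _ _ <
    readAlong (orderFilling (card_cd α) keyRLBT keyRLBT_injective) _ _ ↔ _
  obtain ⟨a, rfl⟩ := (orderFilling (card_cd α) keyRLBT keyRLBT_injective).surjective p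
  obtain ⟨b, rfl⟩ := (orderFilling (card_cd α) keyRLBT keyRLBT_injective).surjective q
  have hmono : ∀ a b : cd α, orderFilling (card_cd α) keyRLBT keyRLBT_injective a <
      orderFilling (card_cd α) keyRLBT keyRLBT_injective b → a.1.2 ≤ b.1.2 := by
    intro a b hab
    rw [orderFilling_keyRLBT_lt_iff] at hab
    omega
  have key := (exists_mem_partialSums_iff (ρ := Prod.snd) hmono take_blocks_sum
    (a := a) (b := b)).not
  push Not at key
  simp only [Set.mem_compl_iff]
  rw [key, readAlong_apply, readAlong_apply, sourceSYCT_lt_iff]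
  rw [orderFilling_keyRLBT_lt_iff] at hpq
  omega

end Canonical

end HeckeDiagrams

/-! ### Transfer of the general results to the canonical class -/

open HeckeDiagrams

theorem mainTheorem8 (n : ℕ) (hn : 0 < n) (α : Composition n) :
    ∃ hD : IsDiagram n (canonicalDiagram α),
      IsFree (canonicalDiagram α) ∧
      IsInterval (canonicalWords α) ∧
      -- the class consists of the intervals of the standard tableaux on the reflected diagram
      canonicalIntervalClass α =
        {I | ∃ T ∈ stdTableaux n (reflectX (canonicalDiagram α)),
          I = sigmaL (fillingPoset (unreflect T))} ∧
      -- its minimum and its maximum, by means of the unique sink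
      (∃ τ : Filling n (cd α), IsSink α τ ∧ (∀ υ, IsSink α υ → υ = τ) ∧
        leL (w0 (partialSums n α.blocks)ᶜ) (readRLBT τ) ∧
        IsMinOf (canonicalIntervalClass α)
          (intervalL (w0 (partialSums n α.blocks)ᶜ) (readRLBT τ)) ∧
        leL (readAlong (rowOrder α τ) (sourceSYCT α))
          (w1 (partialSums n (rowLengths (canonicalDiagram α)))) ∧
        IsMaxOf (canonicalIntervalClass α)
          (intervalL (readAlong (rowOrder α τ) (sourceSYCT α))
            (w1 (partialSums n (rowLengths (canonicalDiagram α))))) ∧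
        readAlong (rowOrder α τ) (sourceSYCT α) = readLRTB (columnTableau hD.1) ∧
        readAlong (rowOrder α τ) τ =
          w1 (partialSums n (rowLengths (canonicalDiagram α)))) ∧
      -- the poset isomorphism
      (∃ Φ : stdTableaux n (reflectX (canonicalDiagram α)) ≃ canonicalIntervalClass α,
        (∀ T, (Φ T).1 = sigmaL (fillingPoset (unreflect T.1))) ∧
        ∀ T U, tableauLE T.1 U.1 ↔ classLE (Φ T).1 (Φ U).1) := by
  have hD : IsDiagram n (canonicalDiagram α) := isDiagram_canonicalDiagram
  have h := hD.1
  have hf : IsFree (canonicalDiagram α) := isFree_canonicalDiagram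
  have hR := isAntiTableau_keyTBLR h
  have hR' := isAntiTableau_keyLRTB h
  have hw := canonicalWords_eq h
  -- The sink is the filling of $\mathrm{cd}(\alpha)$ that corresponds to the row tableau.
  obtain ⟨τ, hτ⟩ := exists_push (rowTableau h)
  have hw0 : w0 (partialSums n α.blocks)ᶜ =
      readAlong (orderFilling h keyTBLR keyTBLR_injective) (columnTableau h) := by
    rw [w0_eq_readRLBT, readRLBT_eq h, push_sourceSYCT h]
  have hw1 := w1_rowLengths h fun b hb => (hD.2.1 b hb).2
  have hsink : readRLBT τ =
      readAlong (orderFilling h keyTBLR keyTBLR_injective) (rowTableau h) := by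
    rw [readRLBT_eq h, hτ]
  have hsrc : readAlong (rowOrder α τ) (sourceSYCT α) =
      readAlong (orderFilling h keyLRTB keyLRTB_injective) (columnTableau h) := by
    rw [← readAlong_push, push_rowOrder h hτ, push_sourceSYCT h]
  refine ⟨hD, hf, ?_, ?_, ⟨τ, isSink_of_push_eq h hτ, ?_, ?_, ?_, ?_, ?_, ?_, ?_⟩, ?_⟩
  · rw [hw]
    exact ⟨_, _, leL_columnTableau_rowTableau h hR, sigmaL_eq_intervalL h hR⟩
  · rw [canonicalIntervalClass, hw]
    exact eqClass_sigmaL_eq_reflect h hf hR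
  · intro υ hυ
    exact push_injective ((push_eq_of_isSink h hυ).trans hτ.symm)
  · rw [hw0, hsink]
    exact leL_columnTableau_rowTableau h hR
  · rw [hw0, hsink, ← sigmaL_eq_intervalL h hR, canonicalIntervalClass, hw]
    exact isMinOf_keyTBLR h hf hR
  · rw [hsrc, hw1]
    exact leL_columnTableau_rowTableau h hR'
  · rw [hsrc, hw1, ← sigmaL_eq_intervalL h hR', canonicalIntervalClass, hw]
    exact isMaxOf_keyLRTB h hf hR
  · exact hsrc
  · rw [hw1, ← readAlong_push, push_rowOrder h hτ, hτ]
  · rw [canonicalIntervalClass, hw]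
    exact exists_equiv_eqClass h hf hR
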